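/- Let $k,\ell\ge 1$, $p=k+\ell$, $\alpha\in(0,1)$, and let $V_i=(X_i^\top\,R_i^\top)^\top$, $i\ge 1$, be iid random vectors in $\mathbb R^k\times\mathbb R^\ell$ with square-integrable entries and covariance matrix $\Sigma$. Let $\lambda>0$, or let $\lambda=0$ and $\Sigma$ be invertible. For a $p\times p$ matrix $M$ write $M^{11},M^{12},M^{21},M^{22}$ for its blocks with respect to $p=k+\ell$ and $M/M^{11}=M^{22}-M^{21}(M^{11})^{-1}M^{12}$. Put $\Sigma_\lambda=\Sigma+\lambda I_p$, $V_c=V_1-\mathbb E[V_1]=(X_c^\top\,R_c^\top)^\top$, and for a real random variable $\xi$ and $u\in(0,1)$ let $q_u(\xi)=\inf\{r\in\mathbb R:\mathbb P(\xi>r)\le 1-u\}$. For $n\ge1$ let $\overline X_n,\overline R_n$ be the means of $X_1,\dots,X_n$ and of $R_1,\dots,R_n$, let $B_n$ be the $n\times p$ matrix with rows $(V_i-\frac1n\sum_{m=1}^nV_m)^\top$, and set $\widehat\Sigma=\frac1nB_n^\top B_n+\lambda I_p$ and $P_n=B_n(B_n^\top B_n+n\lambda I_p)^{-1}B_n^\top$.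 Let $q_{n,\alpha}$ be $n$ times the $\lceil(1-\alpha)(n+1)\rceil$-th smallest diagonal entry of $P_n$, and, with $X^c_{n+1}=X_{n+1}-\overline X_n$, $$\mathcal A_n=\widehat\Sigma/\widehat\Sigma^{11},\qquad Z_0^n=\widehat\Sigma^{21}(\widehat\Sigma^{11})^{-1}X^c_{n+1}+\overline R_n,$$ $$\rho_{n,\alpha}=\frac{q_{n,\alpha}+1}{1-(q_{n,\alpha}+1)/n}-1-(X^c_{n+1})^\top(\widehat\Sigma^{11})^{-1}X^c_{n+1}.$$ Let $\mathcal E^n_\alpha=\mathbb R^\ell$ if $q_{n,\alpha}\ge n-1$, and $\mathcal E^n_\alpha=\{z\in\mathbb R^\ell:(z-Z_0^n)^\top\mathcal A_n^{-1}(z-Z_0^n)\le\rho_{n,\alpha}\}$ otherwise. (Any fixed measurable convention may be used for these quantities where they are undefined; for $\lambda=0$ the matrix $\widehat\Sigma$ is almost surely invertible for all large $n$.) Assume that the quantile function $u\mapsto q_u(\|\Sigma_\lambda^{-1/2}V_c\|^2)$ is continuous on a neighbourhood of $1-\alpha$, and put $q^\infty=q_{1-\alpha}(V_c^\top\Sigma_\lambda^{-1}V_c)$.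 Then, as $n\to\infty$: 1. Almost surely, $q_{n,\alpha}\to q^\infty$ and $\mathcal A_n\to(L^\top\Sigma_\lambda^{-1}L)^{-1}=\Sigma_\lambda/\Sigma_\lambda^{11}$, where $L$ is the $p\times\ell$ matrix with $L^\top=(0\ |\ I_\ell)$. In distribution, $\rho_{n,\alpha}\to q^\infty-X_c^\top(\Sigma_\lambda^{11})^{-1}X_c$ and $Z_0^n\to\Sigma^{21}(\Sigma_\lambda^{11})^{-1}X_c+\mathbb E[R_1]$. 2. In distribution (as random variables in $[0,\infty]$), with $v_\ell=\pi^{\ell/2}/\Gamma(\ell/2+1)$ and $(x)_+^{s}=\max(0,x)^s$, $$\mathrm{Vol}(\mathcal E^n_\alpha)\to v_\ell\sqrt{\det(\Sigma_\lambda/\Sigma_\lambda^{11})}\,\bigl(q^\infty-X_c^\top(\Sigma_\lambda^{11})^{-1}X_c\bigr)_+^{\ell/2}.$$ If $\mathbb P(X_c^\top(\Sigma_\lambda^{11})^{-1}X_c=q^\infty)=0$, then $$\mathbb P(\mathcal E^n_\alpha=\varnothing)\to\mathbb P\bigl(X_c^\top(\Sigma_\lambda^{11})^{-1}X_c>q^\infty\bigr).$$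 In all cases, $\mathbb P(X_c^\top(\Sigma_\lambda^{11})^{-1}X_c>q^\infty)\le\alpha$. -/

import Mathlib

open MeasureTheory ProbabilityTheory Filter Topology
open scoped ENNReal Matrix

noncomputable section

namespace CCLE

/-! ### Generic notions -/

/-- Schur complement `M / M₁₁ = M₂₂ - M₂₁ M₁₁⁻¹ M₁₂` of a block matrix. -/
def schur {k l : ℕ} (M : Matrix (Fin k ⊕ Fin l) (Fin k ⊕ Fin l) ℝ) : Matrix (Fin l) (Fin l) ℝ :=
  M.toBlocks₂₂ - M.toBlocks₂₁ * M.toBlocks₁₁⁻¹ * M.toBlocks₁₂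

/-- The block extraction matrix `L` with `Lᵀ = (0 | I)`. -/
def extractL (k l : ℕ) : Matrix (Fin k ⊕ Fin l) (Fin l) ℝ :=
  Matrix.fromRows 0 1

/-- The matrix `M ^ (-1/2)` of a symmetric positive definite matrix `M`, through the spectral
functional calculus. -/
def invSqrt {ι : Type*} [Fintype ι] [DecidableEq ι] (M : Matrix ι ι ℝ) : Matrix ι ι ℝ :=
  cfc (fun x : ℝ => (Real.sqrt x)⁻¹) M

/-- Order statistic: the `m`-th smallest entry (`1 ≤ m ≤ n`) of the tuple `x`;
the value is `0` if `m` is out of range. -/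
def orderStat {n : ℕ} (x : Fin n → ℝ) (m : ℕ) : ℝ :=
  if h : 1 ≤ m ∧ m ≤ n then x (Tuple.sort x ⟨m - 1, by omega⟩) else 0

/-- Quantile of order `u` of a real random variable `ξ`, i.e. `inf {r | ℙ(ξ > r) ≤ 1 - u}`. -/
def quantile {Ω : Type*} [MeasurableSpace Ω] (μ : Measure Ω) (ξ : Ω → ℝ) (u : ℝ) : ℝ :=
  sInf {r : ℝ | μ.real {ω | r < ξ ω} ≤ 1 - u}

/-- Volume of the unit ball of `ℝ^l`. -/
def unitBallVol (l : ℕ) : ℝ :=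
  Real.pi ^ ((l : ℝ) / 2) / Real.Gamma ((l : ℝ) / 2 + 1)

/-! ### Empirical quantities

Below `v : ℕ → ℝ^(k+l)` is a sequence of observations. The first `n` of them, `v 0, …, v (n-1)`,
form the calibration sample and `v n` is the new observation; `v i (Sum.inl j)` are the
coordinates of the covariate part `X` and `v i (Sum.inr j)` those of the residual part `R`. -/

section Empirical

/-- Empirical mean of the first `n` observations. -/
def empMean {ι : Type*} (v : ℕ → ι → ℝ) (n : ℕ) : ι → ℝ :=
  fun j => (n : ℝ)⁻¹ * ∑ i : Fin n, v i j

/-- The matrix `B_n` of the `n` observations (as rows), centered by their empirical mean. -/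
def centered {ι : Type*} (v : ℕ → ι → ℝ) (n : ℕ) : Matrix (Fin n) ι ℝ :=
  Matrix.of fun i j => v i j - empMean v n j

/-- The empirical ridge covariance matrix `n⁻¹ B_nᵀ B_n + lam I`. -/
def empCov {ι : Type*} [DecidableEq ι] (lam : ℝ) (v : ℕ → ι → ℝ) (n : ℕ) : Matrix ι ι ℝ :=
  (n : ℝ)⁻¹ • ((centered v n)ᵀ * centered v n) + lam • (1 : Matrix ι ι ℝ)

/-- The regularized projector `P_n = B_n (B_nᵀ B_n + n lam I)⁻¹ B_nᵀ`. -/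
def projP {ι : Type*} [Fintype ι] [DecidableEq ι] (lam : ℝ) (v : ℕ → ι → ℝ) (n : ℕ) :
    Matrix (Fin n) (Fin n) ℝ :=
  centered v n * ((centered v n)ᵀ * centered v n + (n * lam) • (1 : Matrix ι ι ℝ))⁻¹ *
    (centered v n)ᵀ

/-- `q_{n,α}`: `n` times the order statistic of order `⌈(1-α)(n+1)⌉` of the diagonal of `P_n`. -/
def qEmp {ι : Type*} [Fintype ι] [DecidableEq ι] (lam α : ℝ) (v : ℕ → ι → ℝ) (n : ℕ) : ℝ :=
  n * orderStat (fun i : Fin n => projP lam v n i i) ⌈(1 - α) * (n + 1)⌉₊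

variable {k l : ℕ}

/-- The matrix `A_n`. -/
def matA (lam : ℝ) (v : ℕ → (Fin k ⊕ Fin l) → ℝ) (n : ℕ) : Matrix (Fin l) (Fin l) ℝ :=
  schur (empCov lam v n)

/-- The centered new covariate `X_{n+1} - n⁻¹ ∑_{i ≤ n} X_i`. -/
def newX (v : ℕ → (Fin k ⊕ Fin l) → ℝ) (n : ℕ) : Fin k → ℝ :=
  fun j => v n (Sum.inl j) - empMean v n (Sum.inl j)

/-- The center `Z_0^n`. -/
def center (lam : ℝ) (v : ℕ → (Fin k ⊕ Fin l) → ℝ) (n : ℕ) : Fin l → ℝ :=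
  ((empCov lam v n).toBlocks₂₁ * (empCov lam v n).toBlocks₁₁⁻¹) *ᵥ newX v n +
    fun j => empMean v n (Sum.inr j)

/-- The squared radius `ρ_{n,α}`. -/
def rho (lam α : ℝ) (v : ℕ → (Fin k ⊕ Fin l) → ℝ) (n : ℕ) : ℝ :=
  (qEmp lam α v n + 1) / (1 - (qEmp lam α v n + 1) / n) - 1 -
    newX v n ⬝ᵥ ((empCov lam v n).toBlocks₁₁⁻¹ *ᵥ newX v n)

/-- The confidence region: all of `ℝ^l` if `q_{n,α} ≥ n - 1`, and otherwise the ellipsoid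
`(z - Z_0^n)ᵀ A_n⁻¹ (z - Z_0^n) ≤ ρ_{n,α}`. -/
def region (lam α : ℝ) (v : ℕ → (Fin k ⊕ Fin l) → ℝ) (n : ℕ) : Set (Fin l → ℝ) :=
  {z | qEmp lam α v n < (n : ℝ) - 1 →
    (z - center lam v n) ⬝ᵥ ((matA lam v n)⁻¹ *ᵥ (z - center lam v n)) ≤ rho lam α v n}

end Empirical

/-! ### Population quantities -/

section Population

variable {Ω : Type*} [MeasurableSpace Ω]

/-- Mean vector of a random vector. -/
def meanVec {ι : Type*} (μ : Measure Ω) (ξ : Ω → ι → ℝ) : ι → ℝ :=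
  fun j => ∫ ω, ξ ω j ∂μ

/-- Ridge covariance matrix `Cov(ξ) + lam I` of a random vector. -/
def ridgeCov {ι : Type*} [DecidableEq ι] (μ : Measure Ω) (lam : ℝ) (ξ : Ω → ι → ℝ) :
    Matrix ι ι ℝ :=
  Matrix.of (fun i j => cov[fun ω => ξ ω i, fun ω => ξ ω j; μ]) + lam • (1 : Matrix ι ι ℝ)

/-- The score `‖Σ_lam^(-1/2) (ξ - 𝔼 ξ)‖²`, with the Euclidean norm. -/
def normScore {ι : Type*} [Fintype ι] [DecidableEq ι] (μ : Measure Ω) (lam : ℝ)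
    (ξ : Ω → ι → ℝ) (ω : Ω) : ℝ :=
  ‖WithLp.toLp 2 (invSqrt (ridgeCov μ lam ξ) *ᵥ (ξ ω - meanVec μ ξ))‖ ^ 2

/-- `q^∞_{1-α}`: the quantile of order `1 - α` of `(ξ - 𝔼 ξ)ᵀ Σ_lam⁻¹ (ξ - 𝔼 ξ)`. -/
def qLim {ι : Type*} [Fintype ι] [DecidableEq ι] (μ : Measure Ω) (lam α : ℝ)
    (ξ : Ω → ι → ℝ) : ℝ :=
  quantile μ (fun ω => (ξ ω - meanVec μ ξ) ⬝ᵥ ((ridgeCov μ lam ξ)⁻¹ *ᵥ (ξ ω - meanVec μ ξ)))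
    (1 - α)

variable {k l : ℕ}

/-- The centered covariate part `X_c` of a random vector with values in `ℝ^(k+l)`. -/
def limX (μ : Measure Ω) (ξ : Ω → (Fin k ⊕ Fin l) → ℝ) (ω : Ω) : Fin k → ℝ :=
  fun j => ξ ω (Sum.inl j) - meanVec μ ξ (Sum.inl j)

/-- The quadratic form `X_cᵀ (Σ_lam¹¹)⁻¹ X_c`. -/
def quadX (μ : Measure Ω) (lam : ℝ) (ξ : Ω → (Fin k ⊕ Fin l) → ℝ) (ω : Ω) : ℝ :=
  limX μ ξ ω ⬝ᵥ ((ridgeCov μ lam ξ).toBlocks₁₁⁻¹ *ᵥ limX μ ξ ω)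

/-- The limit center `Z_0^∞ = Σ²¹ (Σ_lam¹¹)⁻¹ X_c + 𝔼 R`. -/
def limCenter (μ : Measure Ω) (lam : ℝ) (ξ : Ω → (Fin k ⊕ Fin l) → ℝ) (ω : Ω) : Fin l → ℝ :=
  ((ridgeCov μ lam ξ).toBlocks₂₁ * (ridgeCov μ lam ξ).toBlocks₁₁⁻¹) *ᵥ limX μ ξ ω +
    fun j => meanVec μ ξ (Sum.inr j)

/-- The limit volume `v_l √(det (Σ_lam / Σ_lam¹¹)) (q^∞ - X_cᵀ (Σ_lam¹¹)⁻¹ X_c)_+ ^ (l/2)`. -/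
def limVol (μ : Measure Ω) (lam α : ℝ) (ξ : Ω → (Fin k ⊕ Fin l) → ℝ) (ω : Ω) : ℝ :=
  unitBallVol l * Real.sqrt (schur (ridgeCov μ lam ξ)).det *
    (max 0 (qLim μ lam α ξ - quadX μ lam ξ ω)) ^ ((l : ℝ) / 2)

end Population

end CCLE

end

noncomputable section

namespace CCLE

/-! ### Positive definite matrices -/

/-! By the strong law, the empirical mean and ridge covariance converge almost surely to their
population versions, and the limit covariance is positive definite. Inverses, Schur complements and
determinants then converge by continuity.

The number `n * P_n i i` is the quadratic score of the `i`-th observation computed with these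
estimates (`mul_projP_apply_self`), so `qEmp` is an empirical quantile of scores with estimated
parameters. The estimated scores converge uniformly on compact sets only. This suffices, because a
compact set carries almost all the mass of a closed one and the strong law counts the observations
in it (`ae_eventually_lt_card_of_isClosed`). Continuity of the quantile function makes the limit
unique (`ae_tendsto_qEmp`).

The radius, center and region also involve the new observation, which does not converge. It is
independent of the calibration sample and has the law of `V 0`, so it may be replaced by a fixed
point `x`. For almost every sample there is convergence for each such `x`, and dominated convergence
on the product space gives the limits in distribution (`tendsto_integral_of_ae_tendsto_update`).

Volumes come from the explicit formula for ellipsoids. Emptiness is the sign of the radius, which is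
stable away from the event that the limit radius is zero. The bound by `α` holds because the block
quadratic form is dominated by the full one (`dotProduct_inv_toBlocks₁₁_le`). -/

lemma posSemidef_covariance {ι : Type*} [Fintype ι] {Ω : Type*} [MeasurableSpace Ω] {μ : Measure Ω}
    [IsProbabilityMeasure μ] {ξ : Ω → ι → ℝ} (hξ : ∀ j, MemLp (fun ω => ξ ω j) 2 μ) :
    (Matrix.of (fun i j => cov[fun ω => ξ ω i, fun ω => ξ ω j; μ])).PosSemidef := by
  refine .of_dotProduct_mulVec_nonneg ?_ fun x => ?_
  · ext i j
    exact covariance_comm _ _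
  -- The quadratic form at `x` is the variance of `∑ i, x i * ξ i`.
  · have h : 0 ≤ cov[fun ω => ∑ i, x i * ξ ω i, fun ω => ∑ i, x i * ξ ω i; μ] := by
      rw [covariance_self (by
        exact (memLp_finsetSum _ fun i _ => (hξ i).const_mul (x i)).aestronglyMeasurable.aemeasurable)]
      exact variance_nonneg _ _
    rw [covariance_fun_sum_fun_sum (fun i => (hξ i).const_mul _)
      (fun i => (hξ i).const_mul _)] at h
    have hc : ∀ i j, cov[fun ω => x i * ξ ω i, fun ω => x j * ξ ω j; μ] =
        x i * (x j * cov[fun ω => ξ ω i, fun ω => ξ ω j; μ]) := fun i j => by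
      rw [covariance_const_mul_left, covariance_const_mul_right]
    rw [Finset.sum_congr rfl fun i _ => Finset.sum_congr rfl fun j _ => hc i j] at h
    refine h.trans_eq ?_
    simp only [dotProduct, Matrix.mulVec, Matrix.of_apply, star_trivial, Finset.mul_sum]
    exact Finset.sum_congr rfl fun i _ => Finset.sum_congr rfl fun j _ => by ring

section PosDef

variable {ι : Type*} [Fintype ι] [DecidableEq ι]

lemma invSqrt_transpose (M : Matrix ι ι ℝ) : (invSqrt M)ᵀ = invSqrt M := by
  have h : IsSelfAdjoint (invSqrt M) := cfc_predicate _ _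
  rw [← Matrix.conjTranspose_eq_transpose_of_trivial]
  exact h

lemma invSqrt_mul_self {M : Matrix ι ι ℝ} (hM : M.PosDef) : invSqrt M * invSqrt M = M⁻¹ := by
  have hs : IsSelfAdjoint M := hM.isHermitian
  have hpos : ∀ x ∈ spectrum ℝ M, 0 < x := by
    intro x hx
    rw [hM.isHermitian.spectrum_real_eq_range_eigenvalues] at hx
    obtain ⟨i, rfl⟩ := hx
    exact hM.eigenvalues_pos i
  have hc : ContinuousOn (fun x : ℝ => (Real.sqrt x)⁻¹) (spectrum ℝ M) :=
    (Real.continuous_sqrt.continuousOn).inv₀ fun x hx => (Real.sqrt_pos.2 (hpos x hx)).ne'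
  have hi : ContinuousOn (fun x : ℝ => x⁻¹) (spectrum ℝ M) :=
    continuousOn_id.inv₀ fun x hx => (hpos x hx).ne'
  have h1 : invSqrt M * invSqrt M = cfc (fun x : ℝ => x⁻¹) M := by
    unfold invSqrt
    rw [← cfc_mul _ _ M hc hc]
    refine cfc_congr fun x hx => ?_
    rw [← mul_inv, Real.mul_self_sqrt (hpos x hx).le]
  have h2 : cfc (fun x : ℝ => x⁻¹) M * M = 1 := by
    conv_lhs => enter [2]; rw [← cfc_id ℝ M]
    rw [← cfc_mul _ _ M hi continuousOn_id, ← cfc_one ℝ M]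
    refine cfc_congr fun x hx => ?_
    simp [(hpos x hx).ne']
  rw [h1, Matrix.inv_eq_left_inv h2]

lemma norm_sq_invSqrt_mulVec {M : Matrix ι ι ℝ} (hM : M.PosDef) (x : ι → ℝ) :
    ‖WithLp.toLp 2 (invSqrt M *ᵥ x)‖ ^ 2 = x ⬝ᵥ (M⁻¹ *ᵥ x) := by
  rw [EuclideanSpace.real_norm_sq_eq]
  have : ∑ i, (invSqrt M *ᵥ x) i ^ 2 = (invSqrt M *ᵥ x) ⬝ᵥ (invSqrt M *ᵥ x) := by
    simp [dotProduct, sq]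
  rw [this, ← invSqrt_mul_self hM, ← Matrix.mulVec_mulVec, Matrix.dotProduct_mulVec x,
    ← Matrix.mulVec_transpose, invSqrt_transpose]

lemma posSemidef_empCov {lam : ℝ} (hlam : 0 ≤ lam) (v : ℕ → ι → ℝ) (n : ℕ) :
    (empCov lam v n).PosSemidef := by
  unfold empCov
  have h1 := Matrix.posSemidef_conjTranspose_mul_self (centered v n)
  rw [Matrix.conjTranspose_eq_transpose_of_trivial] at h1
  exact (h1.smul (by positivity)).add (Matrix.PosSemidef.one.smul hlam)

lemma posDef_ridgeCov {Ω : Type*} [MeasurableSpace Ω] {μ : Measure Ω}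
    [IsProbabilityMeasure μ] {ξ : Ω → ι → ℝ} (hξ : ∀ j, MemLp (fun ω => ξ ω j) 2 μ) {lam : ℝ}
    (hlam : 0 < lam ∨ (lam = 0 ∧ IsUnit (ridgeCov μ 0 ξ))) : (ridgeCov μ lam ξ).PosDef := by
  have hc := posSemidef_covariance hξ
  rcases hlam with h | ⟨rfl, h⟩
  · exact Matrix.PosDef.posSemidef_add hc (Matrix.PosDef.one.smul h)
  · have h0 : (ridgeCov μ 0 ξ).PosSemidef := by
      simpa [ridgeCov] using hc
    exact h0.posDef_iff_isUnit.2 h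

end PosDef

/-! ### Schur complements -/

section Schur

variable {k l : ℕ} {M : Matrix (Fin k ⊕ Fin l) (Fin k ⊕ Fin l) ℝ}

lemma posDef_toBlocks₁₁ (hM : M.PosDef) : M.toBlocks₁₁.PosDef :=
  hM.submatrix (e := Sum.inl) Sum.inl_injective

lemma toBlocks₁₂_conjTranspose (hM : M.IsHermitian) : M.toBlocks₁₂ᴴ = M.toBlocks₂₁ := by
  ext i j
  have := congr_fun (congr_fun hM (Sum.inr i)) (Sum.inl j)
  simpa [Matrix.toBlocks₁₂, Matrix.toBlocks₂₁] using this

/-- The lower right block of `M⁻¹` is the inverse of the Schur complement, by block inversion. -/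
lemma extractL_mul_inv_mul (hM : M.PosDef) :
    ((extractL k l)ᵀ * M⁻¹ * extractL k l)⁻¹ = schur M := by
  have h11 : Invertible M.toBlocks₁₁ := (posDef_toBlocks₁₁ hM).isUnit.invertible
  have hMi : Invertible M := hM.isUnit.invertible
  have hMi' : Invertible (Matrix.fromBlocks M.toBlocks₁₁ M.toBlocks₁₂ M.toBlocks₂₁ M.toBlocks₂₂) := by
    rw [Matrix.fromBlocks_toBlocks]; exact hMi
  have hS : Invertible (M.toBlocks₂₂ - M.toBlocks₂₁ * ⅟M.toBlocks₁₁ * M.toBlocks₁₂) :=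
    Matrix.invertibleOfFromBlocks₁₁Invertible _ _ _ _
  have hinv := Matrix.invOf_fromBlocks₁₁_eq M.toBlocks₁₁ M.toBlocks₁₂ M.toBlocks₂₁ M.toBlocks₂₂
  rw [Matrix.invOf_eq_nonsing_inv, Matrix.fromBlocks_toBlocks] at hinv
  rw [hinv]
  unfold extractL
  rw [Matrix.transpose_fromRows, Matrix.fromCols_mul_fromBlocks, Matrix.fromCols_mul_fromRows]
  simp only [Matrix.transpose_zero, Matrix.transpose_one, Matrix.zero_mul, Matrix.one_mul,
    Matrix.mul_zero, Matrix.mul_one, zero_add]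
  rw [← Matrix.invOf_eq_nonsing_inv, invOf_invOf, schur, ← Matrix.invOf_eq_nonsing_inv]

lemma posDef_schur (hM : M.PosDef) : (schur M).PosDef := by
  rw [← extractL_mul_inv_mul hM]
  refine Matrix.PosDef.inv ?_
  have : (extractL k l)ᵀ * M⁻¹ * extractL k l = M⁻¹.submatrix Sum.inr Sum.inr := by
    have h := Matrix.fromBlocks_toBlocks M⁻¹
    rw [← h, extractL, Matrix.transpose_fromRows, Matrix.fromCols_mul_fromBlocks,
      Matrix.fromCols_mul_fromRows]
    ext i j
    simp
  rw [this]
  exact hM.inv.submatrix Sum.inr_injective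

/-- Needed for every `n`, including samples with singular covariance when `lam = 0`. If the first
block is singular, its inverse is `0` by convention and only the block `M₂₂` remains. -/
lemma posSemidef_schur (hM : M.PosSemidef) : (schur M).PosSemidef := by
  have h11 : M.toBlocks₁₁.PosSemidef := hM.submatrix Sum.inl
  by_cases hu : IsUnit M.toBlocks₁₁
  · have hd : M.toBlocks₁₁.PosDef := h11.posDef_iff_isUnit.2 hu
    have := hu.invertible
    have h := Matrix.PosDef.fromBlocks₁₁ M.toBlocks₁₂ M.toBlocks₂₂ hd
    rw [toBlocks₁₂_conjTranspose hM.isHermitian, Matrix.fromBlocks_toBlocks] at h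
    exact h.1 hM
  · rw [schur, Matrix.nonsing_inv_eq_ringInverse, Ring.inverse_non_unit _ hu]
    simp only [Matrix.mul_zero, Matrix.zero_mul, sub_zero]
    exact hM.submatrix Sum.inr

/-- With `w = (M₁₁⁻¹ x₁, 0)`, expand the nonnegative form of `M⁻¹` at `x - M w`. The cross terms
contribute `-2 x₁ᵀ M₁₁⁻¹ x₁` and the last term contributes `x₁ᵀ M₁₁⁻¹ x₁`. -/
lemma dotProduct_inv_toBlocks₁₁_le (hM : M.PosDef) (x : Fin k ⊕ Fin l → ℝ) :
    (x ∘ Sum.inl) ⬝ᵥ (M.toBlocks₁₁⁻¹ *ᵥ (x ∘ Sum.inl)) ≤ x ⬝ᵥ (M⁻¹ *ᵥ x) := by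
  have hu : IsUnit M.toBlocks₁₁.det := (Matrix.isUnit_iff_isUnit_det _).1 (posDef_toBlocks₁₁ hM).isUnit
  have huM : IsUnit M.det := (Matrix.isUnit_iff_isUnit_det _).1 hM.isUnit
  set u : Fin k → ℝ := M.toBlocks₁₁⁻¹ *ᵥ (x ∘ Sum.inl) with hu_def
  set w : Fin k ⊕ Fin l → ℝ := Sum.elim u 0 with hw
  have hMt : Mᵀ = M := by
    rw [← Matrix.conjTranspose_eq_transpose_of_trivial]; exact hM.isHermitian
  have h0 := hM.inv.posSemidef.dotProduct_mulVec_nonneg (x - M *ᵥ w)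
  have e1 : M⁻¹ *ᵥ (x - M *ᵥ w) = M⁻¹ *ᵥ x - w := by
    rw [Matrix.mulVec_sub, Matrix.mulVec_mulVec, Matrix.nonsing_inv_mul _ huM, Matrix.one_mulVec]
  have e2 : (M *ᵥ w) ⬝ᵥ (M⁻¹ *ᵥ x) = w ⬝ᵥ x := by
    rw [← Matrix.vecMul_transpose, hMt, ← Matrix.dotProduct_mulVec, Matrix.mulVec_mulVec,
      Matrix.mul_nonsing_inv _ huM, Matrix.one_mulVec]
  have e3 : x ⬝ᵥ w = (x ∘ Sum.inl) ⬝ᵥ u := by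
    simp [dotProduct, hw, Fintype.sum_sum_type]
  have e4 : (M *ᵥ w) ⬝ᵥ w = (x ∘ Sum.inl) ⬝ᵥ u := by
    have h1 : (M *ᵥ w) ⬝ᵥ w = (M.toBlocks₁₁ *ᵥ u) ⬝ᵥ u := by
      simp [dotProduct, hw, Fintype.sum_sum_type, Matrix.mulVec, Matrix.toBlocks₁₁]
    rw [h1, hu_def, Matrix.mulVec_mulVec, Matrix.mul_nonsing_inv _ hu, Matrix.one_mulVec]
  rw [star_trivial, e1, sub_dotProduct, dotProduct_sub, dotProduct_sub, e2, e3, e4,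
    dotProduct_comm w x, e3] at h0
  linarith

end Schur

/-! ### Volume of ellipsoids -/

section Volume

variable {l : ℕ}

/-- Up to translation, the ellipsoid is the preimage of the Euclidean ball of radius `√ρ` under
`A^(-1/2)`, whose determinant has absolute value `(det A)^(-1/2)`. -/
lemma volume_ellipsoid (hl : 1 ≤ l) {A : Matrix (Fin l) (Fin l) ℝ} (hA : A.PosDef)
    (c : Fin l → ℝ) (ρ : ℝ) :
    volume {z : Fin l → ℝ | (z - c) ⬝ᵥ (A⁻¹ *ᵥ (z - c)) ≤ ρ} =
      ENNReal.ofReal (unitBallVol l * Real.sqrt A.det * (max 0 ρ) ^ ((l : ℝ) / 2)) := by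
  have hl0 : (l : ℝ) ≠ 0 := by positivity
  have : Nonempty (Fin l) := ⟨⟨0, hl⟩⟩
  rcases lt_or_ge ρ 0 with hρ | hρ
  · have : {z : Fin l → ℝ | (z - c) ⬝ᵥ (A⁻¹ *ᵥ (z - c)) ≤ ρ} = ∅ := by
      ext z
      have := hA.inv.posSemidef.dotProduct_mulVec_nonneg (z - c)
      simp only [star_trivial] at this
      simp only [Set.mem_ofPred_eq, Set.mem_empty_iff_false, iff_false, not_le]
      linarith
    -- Here `l ≥ 1` matters: for `l = 0` the power `0 ^ 0` would be `1`.
    rw [this, max_eq_left hρ.le, Real.zero_rpow (by positivity)]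
    simp
  have hdet : (invSqrt A).det ^ 2 = A.det⁻¹ := by
    rw [sq, ← Matrix.det_mul, invSqrt_mul_self hA, Matrix.det_nonsing_inv, Ring.inverse_eq_inv']
  have hdpos : 0 < A.det := hA.det_pos
  have hd0 : (invSqrt A).det ≠ 0 := by
    intro h
    rw [h] at hdet
    have := inv_pos.2 hdpos
    rw [← hdet] at this
    simp at this
  have hset : {z : Fin l → ℝ | (z - c) ⬝ᵥ (A⁻¹ *ᵥ (z - c)) ≤ ρ} =
      (fun z => z + -c) ⁻¹' ((Matrix.toLin' (invSqrt A)) ⁻¹'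
        ((WithLp.toLp 2) ⁻¹' (Metric.closedBall (0 : EuclideanSpace ℝ (Fin l)) (Real.sqrt ρ)))) := by
    ext z
    simp only [Set.mem_ofPred_eq, Set.mem_preimage, mem_closedBall_zero_iff, Matrix.toLin'_apply,
      ← sub_eq_add_neg]
    rw [← norm_sq_invSqrt_mulVec hA, Real.le_sqrt (norm_nonneg _) hρ]
  rw [hset, measure_preimage_add_right, Measure.addHaar_preimage_linearMap _ (by
      rwa [LinearMap.det_toLin']),
    (PiLp.volume_preserving_toLp (Fin l)).measure_preimage
      (Metric.isClosed_closedBall.measurableSet.nullMeasurableSet),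
    EuclideanSpace.volume_closedBall, LinearMap.det_toLin', Fintype.card_fin,
    ← ENNReal.ofReal_pow (Real.sqrt_nonneg _), ← ENNReal.ofReal_mul (by positivity),
    ← ENNReal.ofReal_mul (by positivity)]
  congr 1
  have e1 : |((invSqrt A).det)⁻¹| = Real.sqrt A.det := by
    rw [← Real.sqrt_sq_eq_abs, inv_pow, hdet, inv_inv]
  have e2 : Real.sqrt ρ ^ l = ρ ^ ((l : ℝ) / 2) := by
    rw [Real.sqrt_eq_rpow, ← Real.rpow_natCast, ← Real.rpow_mul hρ]
    congr 1; ring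
  have e3 : Real.sqrt Real.pi ^ l = Real.pi ^ ((l : ℝ) / 2) := by
    rw [Real.sqrt_eq_rpow, ← Real.rpow_natCast, ← Real.rpow_mul Real.pi_pos.le]
    congr 1; ring
  rw [e1, e2, e3, max_eq_right hρ, unitBallVol]
  ring

lemma region_eq_empty_iff {k : ℕ} {lam : ℝ} (hlam : 0 ≤ lam) (α : ℝ)
    (v : ℕ → (Fin k ⊕ Fin l) → ℝ) (n : ℕ) :
    region lam α v n = ∅ ↔ qEmp lam α v n < (n : ℝ) - 1 ∧ rho lam α v n < 0 := by
  have hA : (matA lam v n)⁻¹.PosSemidef := (posSemidef_schur (posSemidef_empCov hlam v n)).inv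
  rw [Set.eq_empty_iff_forall_notMem]
  simp only [region, Set.mem_ofPred_eq, Classical.not_imp, not_le]
  constructor
  · intro h
    -- The form vanishes at the center, so the center belongs to the ellipsoid unless the squared
    -- radius is negative.
    simpa using h (center lam v n)
  · rintro ⟨h1, h2⟩ z
    have := hA.dotProduct_mulVec_nonneg (z - center lam v n)
    rw [star_trivial] at this
    exact ⟨h1, h2.trans_le this⟩

end Volume

/-! ### Order statistics -/

/-- Trades sorting for counting, which suits both measurability and the law of large numbers. The
sorted index is `m - 1`, and `m - 1 < card` amounts to `m ≤ card`. -/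
lemma orderStat_le_iff {n m : ℕ} (h1 : 1 ≤ m) (h2 : m ≤ n) (x : Fin n → ℝ) (a : ℝ) :
    orderStat x m ≤ a ↔ m ≤ (Finset.univ.filter fun i => x i ≤ a).card := by
  have hs := Tuple.lt_card_le_iff_apply_le_of_monotone (j := ⟨m - 1, by omega⟩) (a := a)
    (Tuple.monotone_sort x)
  have hc : (Finset.univ.filter fun i => (x ∘ Tuple.sort x) i ≤ a).card =
      (Finset.univ.filter fun i => x i ≤ a).card :=
    Finset.card_equiv (Tuple.sort x) (by simp)
  rw [hc] at hs
  rw [orderStat, dif_pos ⟨h1, h2⟩]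
  exact hs.symm.trans (by simp only; omega)

section Measurability

variable {X : Type*} [MeasurableSpace X]

lemma measurable_orderStat {n : ℕ} {x : X → Fin n → ℝ} (hx : ∀ i, Measurable fun t => x t i)
    (m : ℕ) : Measurable fun t => orderStat (x t) m := by
  by_cases h : 1 ≤ m ∧ m ≤ n
  · refine measurable_of_Iic fun a => ?_
    have : (fun t => orderStat (x t) m) ⁻¹' Set.Iic a =
        {t | m ≤ ∑ i, if x t i ≤ a then 1 else 0} := by
      ext t
      simp only [Set.mem_preimage, Set.mem_Iic, Set.mem_ofPred_eq]
      rw [orderStat_le_iff h.1 h.2, Finset.card_filter]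
    rw [this]
    refine measurableSet_le measurable_const (Finset.measurable_fun_sum _ fun i _ => ?_)
    exact Measurable.ite (measurableSet_le (hx i) measurable_const) measurable_const
      measurable_const
  · simp [orderStat, h]

/-! ### Measurability of matrix operations -/

variable {m n p : Type*} [Fintype n]

lemma measurable_matrix_mul {A : X → Matrix m n ℝ} {B : X → Matrix n p ℝ}
    (hA : ∀ i j, Measurable fun x => A x i j) (hB : ∀ i j, Measurable fun x => B x i j)
    (i : m) (j : p) : Measurable fun x => (A x * B x) i j := by
  simp only [Matrix.mul_apply]
  exact Finset.measurable_fun_sum _ fun k _ => (hA i k).mul (hB k j)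

lemma measurable_mulVec {A : X → Matrix m n ℝ} {b : X → n → ℝ}
    (hA : ∀ i j, Measurable fun x => A x i j) (hb : ∀ i, Measurable fun x => b x i)
    (i : m) : Measurable fun x => (A x *ᵥ b x) i := by
  simp only [Matrix.mulVec, dotProduct]
  exact Finset.measurable_fun_sum _ fun k _ => (hA i k).mul (hb k)

lemma measurable_dotProduct {a b : X → n → ℝ}
    (ha : ∀ i, Measurable fun x => a x i) (hb : ∀ i, Measurable fun x => b x i) :
    Measurable fun x => a x ⬝ᵥ b x := by
  simp only [dotProduct]
  exact Finset.measurable_fun_sum _ fun k _ => (ha k).mul (hb k)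

variable [DecidableEq n]

lemma measurable_det {A : X → Matrix n n ℝ} (hA : ∀ i j, Measurable fun x => A x i j) :
    Measurable fun x => (A x).det := by
  simp only [Matrix.det_apply']
  exact Finset.measurable_fun_sum _ fun σ _ =>
    (Finset.measurable_fun_prod _ fun i _ => hA _ _).const_mul _

lemma measurable_matrix_inv {A : X → Matrix n n ℝ} (hA : ∀ i j, Measurable fun x => A x i j)
    (i j : n) : Measurable fun x => (A x)⁻¹ i j := by
  simp only [Matrix.inv_def, Ring.inverse_eq_inv', Matrix.smul_apply, Matrix.adjugate_apply,
    smul_eq_mul]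
  refine (measurable_det hA).inv.mul (measurable_det fun a b => ?_)
  by_cases h : a = j
  · subst h; simp
  · simpa [Matrix.updateRow_apply, h] using hA a b

end Measurability

/-! ### Measurability of the empirical quantities -/

section EmpiricalMeasurability

variable {ι : Type*}

lemma measurable_obs (i : ℕ) (j : ι) : Measurable fun v : ℕ → ι → ℝ => v i j :=
  (measurable_pi_apply j).comp (measurable_pi_apply i)

lemma measurable_empMean (n : ℕ) (j : ι) : Measurable fun v : ℕ → ι → ℝ => empMean v n j :=
  (Finset.measurable_fun_sum _ fun _ _ => measurable_obs _ _).const_mul _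

lemma measurable_centered (n : ℕ) (i : Fin n) (j : ι) :
    Measurable fun v : ℕ → ι → ℝ => centered v n i j :=
  (measurable_obs _ _).sub (measurable_empMean _ _)

variable [DecidableEq ι]

lemma measurable_empCov (lam : ℝ) (n : ℕ) (i j : ι) :
    Measurable fun v : ℕ → ι → ℝ => empCov lam v n i j :=
  ((measurable_matrix_mul (fun i j => measurable_centered n j i) (measurable_centered n)
    i j).const_mul _).add_const _

variable [Fintype ι]

lemma measurable_qEmp (lam α : ℝ) (n : ℕ) :
    Measurable fun v : ℕ → ι → ℝ => qEmp lam α v n := by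
  refine (measurable_orderStat (fun i => ?_) _).const_mul _
  refine measurable_matrix_mul (fun i j => measurable_matrix_mul (measurable_centered n)
    (measurable_matrix_inv fun i j => ?_) i j) (fun i j => measurable_centered n j i) i i
  exact (measurable_matrix_mul (fun i j => measurable_centered n j i) (measurable_centered n)
    i j).add_const _

variable {k l : ℕ}

lemma measurable_newX (n : ℕ) (j : Fin k) :
    Measurable fun v : ℕ → (Fin k ⊕ Fin l) → ℝ => newX v n j :=
  (measurable_obs _ _).sub (measurable_empMean _ _)

lemma measurable_empCov_toBlocks₁₁_inv (lam : ℝ) (n : ℕ) (i j : Fin k) :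
    Measurable fun v : ℕ → (Fin k ⊕ Fin l) → ℝ => (empCov lam v n).toBlocks₁₁⁻¹ i j :=
  measurable_matrix_inv (fun _ _ => measurable_empCov lam n _ _) i j

lemma measurable_empCov_toBlocks₂₁_mul_inv (lam : ℝ) (n : ℕ) (i : Fin l) (j : Fin k) :
    Measurable fun v : ℕ → (Fin k ⊕ Fin l) → ℝ =>
      ((empCov lam v n).toBlocks₂₁ * (empCov lam v n).toBlocks₁₁⁻¹) i j :=
  measurable_matrix_mul (fun _ _ => measurable_empCov lam n _ _)
    (measurable_empCov_toBlocks₁₁_inv lam n) i j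

lemma measurable_matA (lam : ℝ) (n : ℕ) (i j : Fin l) :
    Measurable fun v : ℕ → (Fin k ⊕ Fin l) → ℝ => matA lam v n i j :=
  (measurable_empCov lam n _ _).sub (measurable_matrix_mul
    (measurable_empCov_toBlocks₂₁_mul_inv lam n) (fun _ _ => measurable_empCov lam n _ _) i j)

lemma measurable_center (lam : ℝ) (n : ℕ) :
    Measurable fun v : ℕ → (Fin k ⊕ Fin l) → ℝ => center lam v n :=
  measurable_pi_lambda _ fun i => (measurable_mulVec
    (measurable_empCov_toBlocks₂₁_mul_inv lam n) (measurable_newX n) i).add (measurable_empMean _ _)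

lemma measurable_rho (lam α : ℝ) (n : ℕ) :
    Measurable fun v : ℕ → (Fin k ⊕ Fin l) → ℝ => rho lam α v n := by
  have hq := measurable_qEmp (ι := Fin k ⊕ Fin l) lam α n
  exact (((hq.add_const 1).div (((hq.add_const 1).div_const _).const_sub _)).sub_const 1).sub
    (measurable_dotProduct (measurable_newX n) fun i =>
      measurable_mulVec (measurable_empCov_toBlocks₁₁_inv lam n) (measurable_newX n) i)

/-- The region is a section of a jointly measurable set, and measures of sections are measurable. -/
lemma measurable_volume_region (lam α : ℝ) (n : ℕ) :
    Measurable fun v : ℕ → (Fin k ⊕ Fin l) → ℝ => volume (region lam α v n) := by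
  set S : Set ((ℕ → (Fin k ⊕ Fin l) → ℝ) × (Fin l → ℝ)) := {p | p.2 ∈ region lam α p.1 n} with hS
  have hz : ∀ i, Measurable fun p : (ℕ → (Fin k ⊕ Fin l) → ℝ) × (Fin l → ℝ) =>
      (p.2 - center lam p.1 n) i := fun i =>
    ((measurable_pi_apply i).comp measurable_snd).sub
      ((measurable_pi_apply i).comp ((measurable_center lam n).comp measurable_fst))
  have hmS : MeasurableSet S := by
    have h1 : MeasurableSet {p : (ℕ → (Fin k ⊕ Fin l) → ℝ) × (Fin l → ℝ) |
        qEmp lam α p.1 n < (n : ℝ) - 1} :=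
      measurableSet_lt ((measurable_qEmp lam α n).comp measurable_fst) measurable_const
    have h2 : MeasurableSet {p : (ℕ → (Fin k ⊕ Fin l) → ℝ) × (Fin l → ℝ) |
        (p.2 - center lam p.1 n) ⬝ᵥ ((matA lam p.1 n)⁻¹ *ᵥ (p.2 - center lam p.1 n)) ≤
          rho lam α p.1 n} := by
      refine measurableSet_le (measurable_dotProduct hz fun i => measurable_mulVec
        (fun i j => ?_) hz i) ((measurable_rho lam α n).comp measurable_fst)
      exact (measurable_matrix_inv (measurable_matA lam n) i j).comp measurable_fst
    have h3 := h1.compl.union h2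
    convert h3 using 1
    ext p
    simp only [hS, region, Set.mem_ofPred_eq, Set.mem_union, Set.mem_compl_iff]
    tauto
  exact measurable_measure_prodMk_left hmS

end EmpiricalMeasurability

/-! ### Dependence on the new observation only through the last coordinate -/

lemma empMean_congr {ι : Type*} {v w : ℕ → ι → ℝ} {n : ℕ} (h : ∀ i < n, v i = w i) :
    empMean v n = empMean w n := by
  ext j
  simp [empMean, fun i : Fin n => h i i.2]

section Update

lemma centered_congr {ι : Type*} {v w : ℕ → ι → ℝ} {n : ℕ} (h : ∀ i < n, v i = w i) :
    centered v n = centered w n := by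
  ext i j
  simp [centered, empMean_congr h, h i i.2]

variable {ι : Type*} [DecidableEq ι]

lemma empCov_congr {v w : ℕ → ι → ℝ} {n : ℕ} (h : ∀ i < n, v i = w i) (lam : ℝ) :
    empCov lam v n = empCov lam w n := by
  simp [empCov, centered_congr h]

lemma qEmp_congr [Fintype ι] {v w : ℕ → ι → ℝ} {n : ℕ} (h : ∀ i < n, v i = w i) (lam α : ℝ) :
    qEmp lam α v n = qEmp lam α w n := by
  simp [qEmp, projP, centered_congr h]

variable {k l : ℕ} {v w : ℕ → (Fin k ⊕ Fin l) → ℝ} {n : ℕ}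

lemma newX_congr (h : ∀ i ≤ n, v i = w i) : newX v n = newX w n := by
  ext j
  simp [newX, h n le_rfl, empMean_congr fun i hi => h i hi.le]

lemma center_congr (h : ∀ i ≤ n, v i = w i) (lam : ℝ) : center lam v n = center lam w n := by
  simp [center, newX_congr h, empMean_congr fun i hi => h i hi.le,
    empCov_congr fun i hi => h i hi.le]

lemma rho_congr (h : ∀ i ≤ n, v i = w i) (lam α : ℝ) : rho lam α v n = rho lam α w n := by
  simp [rho, newX_congr h, qEmp_congr fun i hi => h i hi.le, empCov_congr fun i hi => h i hi.le]

lemma region_congr (h : ∀ i ≤ n, v i = w i) (lam α : ℝ) :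
    region lam α v n = region lam α w n := by
  simp [region, matA, center_congr h, rho_congr h, qEmp_congr fun i hi => h i hi.le,
    empCov_congr fun i hi => h i hi.le]

end Update

/-! ### Quantiles -/

section Quantile

variable {Ω : Type*} [MeasurableSpace Ω] {μ : Measure Ω} [IsProbabilityMeasure μ] {ξ : Ω → ℝ}
  {u r : ℝ}

lemma tail_antitone : Antitone fun r : ℝ => μ.real {ω | r < ξ ω} :=
  fun _ _ h => measureReal_mono fun _ hω => lt_of_le_of_lt h hω

/-- Right continuity of the tail, by continuity of the measure along an increasing union. -/
lemma tendsto_tail_of_tendsto_of_antitone {a : ℕ → ℝ} {b : ℝ}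
    (ha : Antitone a) (hab : ∀ n, b ≤ a n) (hlim : Tendsto a atTop (𝓝 b)) :
    Tendsto (fun n => μ.real {ω | a n < ξ ω}) atTop (𝓝 (μ.real {ω | b < ξ ω})) := by
  have hU : {ω | b < ξ ω} = ⋃ n, {ω | a n < ξ ω} := by
    ext ω
    simp only [Set.mem_ofPred_eq, Set.mem_iUnion]
    constructor
    · exact fun h => (hlim.eventually_lt_const h).exists
    · exact fun ⟨n, hn⟩ => (hab n).trans_lt hn
  rw [hU]
  exact (ENNReal.tendsto_toReal (measure_ne_top _ _)).comp
    (tendsto_measure_iUnion_atTop fun m n h ω hω => lt_of_le_of_lt (ha h) hω)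

/-- Together with `quantile_set_bddBelow`, this makes the `sInf` in `quantile` a genuine infimum
instead of a default value. -/
lemma quantile_set_nonempty (hξ : Measurable ξ) (hu : u < 1) :
    {r : ℝ | μ.real {ω | r < ξ ω} ≤ 1 - u}.Nonempty := by
  have h : Tendsto (fun n : ℕ => μ.real {ω | (n : ℝ) < ξ ω}) atTop (𝓝 0) := by
    have h0 : ⋂ n : ℕ, {ω | (n : ℝ) < ξ ω} = ∅ := by
      ext ω
      obtain ⟨n, hn⟩ := exists_nat_ge (ξ ω)
      simp only [Set.mem_iInter, Set.mem_ofPred_eq, Set.mem_empty_iff_false, iff_false, not_forall,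
        not_lt]
      exact ⟨n, hn⟩
    have := tendsto_measure_iInter_atTop (μ := μ) (s := fun n : ℕ => {ω | (n : ℝ) < ξ ω})
      (fun n => (measurableSet_lt measurable_const hξ).nullMeasurableSet)
      (fun m n h ω (hω : (n : ℝ) < ξ ω) => lt_of_le_of_lt (Nat.cast_le.2 h) hω) ⟨0, measure_ne_top _ _⟩
    rw [h0, measure_empty] at this
    have h1 := (ENNReal.tendsto_toReal ENNReal.zero_ne_top).comp this
    rw [ENNReal.toReal_zero] at h1
    exact h1
  obtain ⟨n, hn⟩ := (h.eventually_lt_const (sub_pos.2 hu)).exists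
  exact ⟨n, hn.le⟩

lemma quantile_set_bddBelow (hu : 0 < u) :
    BddBelow {r : ℝ | μ.real {ω | r < ξ ω} ≤ 1 - u} := by
  have h : Tendsto (fun n : ℕ => μ.real {ω | (-n : ℝ) < ξ ω}) atTop (𝓝 1) := by
    have h0 : ⋃ n : ℕ, {ω | (-n : ℝ) < ξ ω} = Set.univ := by
      ext ω
      obtain ⟨n, hn⟩ := exists_nat_gt (-ξ ω)
      simp only [Set.mem_iUnion, Set.mem_ofPred_eq, Set.mem_univ, iff_true]
      exact ⟨n, by linarith⟩
    have := tendsto_measure_iUnion_atTop (μ := μ) (s := fun n : ℕ => {ω | (-n : ℝ) < ξ ω})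
      (fun m n h ω (hω : (-m : ℝ) < ξ ω) =>
        lt_of_le_of_lt (neg_le_neg (Nat.cast_le.2 h)) hω)
    rw [h0, measure_univ] at this
    have h1 := (ENNReal.tendsto_toReal ENNReal.one_ne_top).comp this
    rw [ENNReal.toReal_one] at h1
    exact h1
  obtain ⟨n, hn⟩ := (h.eventually_const_lt (show 1 - u < 1 by linarith)).exists
  refine ⟨-n, fun r hr => ?_⟩
  by_contra! hlt
  exact absurd (hn.trans_le (tail_antitone hlt.le)) (not_lt.2 hr)

lemma lt_tail_of_lt_quantile (hu : 0 < u) (hr : r < quantile μ ξ u) :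
    1 - u < μ.real {ω | r < ξ ω} :=
  not_le.1 fun h => notMem_of_lt_csInf hr (quantile_set_bddBelow hu) h

lemma tail_le_of_quantile_lt (hξ : Measurable ξ) (hu1 : u < 1)
    (hr : quantile μ ξ u < r) : μ.real {ω | r < ξ ω} ≤ 1 - u := by
  obtain ⟨s, hs, hsr⟩ := exists_lt_of_csInf_lt (quantile_set_nonempty hξ hu1) hr
  exact (tail_antitone hsr.le).trans hs

lemma tail_quantile_le (hξ : Measurable ξ) (hu1 : u < 1) :
    μ.real {ω | quantile μ ξ u < ξ ω} ≤ 1 - u := by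
  set q := quantile μ ξ u
  have hlim : Tendsto (fun n : ℕ => q + 1 / ((n : ℝ) + 1)) atTop (𝓝 q) := by
    simpa using (tendsto_const_nhds (x := q)).add
      (tendsto_one_div_add_atTop_nhds_zero_nat (𝕜 := ℝ))
  refine le_of_tendsto (tendsto_tail_of_tendsto_of_antitone
    (fun m n h => ?_) (fun n => ?_) hlim) (Eventually.of_forall fun n => ?_)
  · gcongr
  · have : 0 < 1 / ((n : ℝ) + 1) := by positivity
    linarith
  · refine tail_le_of_quantile_lt hξ hu1 ?_
    have : 0 < 1 / ((n : ℝ) + 1) := by positivity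
    linarith

/-- This is where continuity of the quantile function enters. If the tail at `r` were at least `1 -
u`, every order `w > u` would have quantile at least `r`, and letting `w` decrease to `u` would give
`r ≤ quantile μ ξ u`. -/
lemma tail_lt_of_quantile_lt (hξ : Measurable ξ) (hu1 : u < 1)
    (hc : ContinuousAt (quantile μ ξ) u) (hr : quantile μ ξ u < r) :
    μ.real {ω | r < ξ ω} < 1 - u := by
  by_contra! h
  refine absurd hr (not_lt.2 ?_)
  refine ge_of_tendsto (hc.tendsto.mono_left nhdsWithin_le_nhds : Tendsto _ (𝓝[>] u) _) ?_
  filter_upwards [Ioo_mem_nhdsGT hu1] with w hw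
  refine le_csInf (quantile_set_nonempty hξ hw.2) fun s hs => ?_
  by_contra! hsr
  have h1 : μ.real {ω | r < ξ ω} ≤ μ.real {ω | s < ξ ω} := tail_antitone hsr.le
  have h2 : μ.real {ω | s < ξ ω} ≤ 1 - w := hs
  linarith [hw.1]

end Quantile

/-! ### Limits of matrices -/

section MatrixLimits

variable {ι : Type*} [Fintype ι] [DecidableEq ι] {A : ℕ → Matrix ι ι ℝ} {B : Matrix ι ι ℝ}

lemma tendsto_matrix_inv (h : Tendsto A atTop (𝓝 B)) (hB : B.PosDef) :
    Tendsto (fun n => (A n)⁻¹) atTop (𝓝 B⁻¹) := by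
  refine (ContinuousAt.tendsto ?_).comp h
  refine continuousAt_matrix_inv _ ?_
  rw [Ring.inverse_eq_inv']
  exact continuousAt_inv₀ hB.det_pos.ne'

lemma eventually_posDef (h : Tendsto A atTop (𝓝 B)) (hB : B.PosDef)
    (hA : ∀ n, (A n).PosSemidef) : ∀ᶠ n in atTop, (A n).PosDef := by
  have hdet : Tendsto (fun n => (A n).det) atTop (𝓝 B.det) :=
    (continuous_id.matrix_det.tendsto B).comp h
  filter_upwards [hdet.eventually_ne hB.det_pos.ne'] with n hn
  exact (hA n).posDef_iff_det_ne_zero.2 hn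

end MatrixLimits

/-! ### Scores and empirical quantiles -/

section Score

variable {ι : Type*} [Fintype ι]

/-- The quadratic score `(x - m)ᵀ N (x - m)`. -/
def score (m : ι → ℝ) (N : Matrix ι ι ℝ) (x : ι → ℝ) : ℝ :=
  (x - m) ⬝ᵥ (N *ᵥ (x - m))

lemma continuous_score :
    Continuous fun p : ((ι → ℝ) × Matrix ι ι ℝ) × (ι → ℝ) => score p.1.1 p.1.2 p.2 := by
  have h1 : Continuous fun p : ((ι → ℝ) × Matrix ι ι ℝ) × (ι → ℝ) => p.2 - p.1.1 := by fun_prop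
  have h2 : Continuous fun p : ((ι → ℝ) × Matrix ι ι ℝ) × (ι → ℝ) => p.1.2 := by fun_prop
  exact h1.dotProduct (h2.matrix_mulVec h1)

lemma continuous_score_right (m : ι → ℝ) (N : Matrix ι ι ℝ) : Continuous (score m N) :=
  continuous_score.comp (Continuous.prodMk_right (m, N))

/-- Joint continuity in parameters and point, with compactness of `K`, gives one neighbourhood of
the limit parameters valid for all `x ∈ K`. -/
lemma eventually_score_of_isCompact {m : ℕ → ι → ℝ} {m₀ : ι → ℝ} {N : ℕ → Matrix ι ι ℝ}
    {N₀ : Matrix ι ι ℝ} (hm : Tendsto m atTop (𝓝 m₀)) (hN : Tendsto N atTop (𝓝 N₀))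
    {K : Set (ι → ℝ)} (hK : IsCompact K) {U : Set ℝ} (hU : IsOpen U)
    (h : ∀ x ∈ K, score m₀ N₀ x ∈ U) : ∀ᶠ n in atTop, ∀ x ∈ K, score (m n) (N n) x ∈ U := by
  have h1 : ∀ᶠ p in 𝓝 (m₀, N₀), ∀ x ∈ K, score p.1 p.2 x ∈ U :=
    hK.eventually_forall_of_forall_eventually fun x hx =>
      (continuous_score.tendsto ((m₀, N₀), x)).eventually (hU.mem_nhds (h x hx))
  exact (hm.prodMk_nhds hN).eventually h1

variable [DecidableEq ι]

/-- The matrix inverted in `projP` is `n` times `empCov`, so the factor `n` cancels. -/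
lemma mul_projP_apply_self {lam : ℝ} {v : ℕ → ι → ℝ} {n : ℕ} (hn : 0 < n)
    (hM : (empCov lam v n).PosDef) (i : Fin n) :
    n * projP lam v n i i = score (empMean v n) (empCov lam v n)⁻¹ (v i) := by
  have hn0 : (n : ℝ) ≠ 0 := by positivity
  have h1 : (centered v n)ᵀ * centered v n + (n * lam) • (1 : Matrix ι ι ℝ) =
      (n : ℝ) • empCov lam v n := by
    rw [empCov, smul_add, smul_smul, smul_smul, mul_inv_cancel₀ hn0, one_smul]
  have h2 : ((n : ℝ) • empCov lam v n)⁻¹ = (n : ℝ)⁻¹ • (empCov lam v n)⁻¹ := by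
    refine Matrix.inv_eq_left_inv ?_
    rw [Matrix.smul_mul, Matrix.mul_smul, smul_smul, inv_mul_cancel₀ hn0, one_smul,
      Matrix.nonsing_inv_mul _ ((Matrix.isUnit_iff_isUnit_det _).1 hM.isUnit)]
  rw [projP, h1, h2, Matrix.mul_smul, Matrix.smul_mul, Matrix.smul_apply, smul_eq_mul, ← mul_assoc,
    mul_inv_cancel₀ hn0, one_mul, score, Matrix.dotProduct_mulVec]
  simp only [Matrix.mul_apply, Matrix.vecMul, dotProduct, Matrix.transpose_apply, centered,
    Matrix.of_apply, Pi.sub_apply]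

lemma qEmp_le_iff {lam α : ℝ} {v : ℕ → ι → ℝ} {n : ℕ} (hn : 0 < n)
    (hα : α < 1) (hm : ⌈(1 - α) * (n + 1)⌉₊ ≤ n) (hM : (empCov lam v n).PosDef) (r : ℝ) :
    qEmp lam α v n ≤ r ↔ ⌈(1 - α) * (n + 1)⌉₊ ≤ (Finset.univ.filter fun i : Fin n =>
      score (empMean v n) (empCov lam v n)⁻¹ (v i) ≤ r).card := by
  have hn0 : (0 : ℝ) < n := by positivity
  have hm1 : 1 ≤ ⌈(1 - α) * ((n : ℝ) + 1)⌉₊ :=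
    Nat.ceil_pos.2 (mul_pos (by linarith) (by positivity))
  rw [qEmp, ← le_div_iff₀' hn0, orderStat_le_iff hm1 hm]
  simp_rw [le_div_iff₀' hn0, mul_projP_apply_self hn hM]

lemma tendsto_rank_div {α : ℝ} (hα : α < 1) :
    Tendsto (fun n : ℕ => (⌈(1 - α) * ((n : ℝ) + 1)⌉₊ : ℝ) / n) atTop (𝓝 (1 - α)) := by
  have h1 : Tendsto (fun n : ℕ => (⌈(1 - α) * ((n : ℝ) + 1)⌉₊ : ℝ) / (n + 1)) atTop
      (𝓝 (1 - α)) := by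
    have h := (tendsto_nat_ceil_mul_div_atTop (R := ℝ) (sub_nonneg.2 hα.le)).comp
      (tendsto_natCast_atTop_atTop.comp (tendsto_add_atTop_nat 1))
    refine h.congr fun n => ?_
    simp
  have h2 : Tendsto (fun n : ℕ => ((n : ℝ) + 1) / n) atTop (𝓝 1) := by
    have h := tendsto_const_nhds (x := (1 : ℝ)).add tendsto_one_div_atTop_nhds_zero_nat
    rw [add_zero] at h
    refine h.congr' ?_
    filter_upwards [eventually_gt_atTop 0] with n hn
    field_simp
  have h3 := h1.mul h2
  rw [mul_one] at h3
  refine h3.congr' ?_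
  filter_upwards [eventually_gt_atTop 0] with n hn
  field_simp

lemma eventually_rank_le {α : ℝ} (hα0 : 0 < α) (hα : α < 1) :
    ∀ᶠ n : ℕ in atTop, ⌈(1 - α) * ((n : ℝ) + 1)⌉₊ ≤ n := by
  filter_upwards [(tendsto_rank_div hα).eventually_lt_const (show 1 - α < 1 by linarith),
    eventually_gt_atTop 0] with n h1 hn
  rw [div_lt_one (by positivity)] at h1
  exact_mod_cast h1.le

end Score

/-! ### Almost sure limits -/

lemma ae_tendsto_average {Ω : Type*} [MeasurableSpace Ω] {μ : Measure Ω} {ι : Type*}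
    {V : ℕ → Ω → ι → ℝ} (hindep : iIndepFun V μ)
    (hident : ∀ i, IdentDistrib (V i) (V 0) μ μ)
    {f : (ι → ℝ) → ℝ} (hf : Measurable f) (hint : Integrable (fun ω => f (V 0 ω)) μ) :
    ∀ᵐ ω ∂μ, Tendsto (fun n : ℕ => (n : ℝ)⁻¹ * ∑ i : Fin n, f (V i ω)) atTop
      (𝓝 (∫ ω, f (V 0 ω) ∂μ)) := by
  have h := strong_law_ae_real (fun i ω => f (V i ω)) hint
    (fun i j hij => (hindep.indepFun hij).comp hf hf) (fun i => (hident i).comp hf)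
  filter_upwards [h] with ω hω
  refine hω.congr fun n => ?_
  rw [Finset.sum_range, div_eq_inv_mul]

section AlmostSure

variable {Ω : Type*} [MeasurableSpace Ω] {μ : Measure Ω} [IsProbabilityMeasure μ]
  {ι : Type*} [Fintype ι] {V : ℕ → Ω → ι → ℝ}

variable (hindep : iIndepFun V μ) (hident : ∀ i, IdentDistrib (V i) (V 0) μ μ)
  (hsq : ∀ j, MemLp (fun ω => V 0 ω j) 2 μ)

include hindep hident hsq

lemma ae_tendsto_empMean :
    ∀ᵐ ω ∂μ, Tendsto (fun n => empMean (fun i => V i ω) n) atTop (𝓝 (meanVec μ (V 0))) := by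
  have h : ∀ j, ∀ᵐ ω ∂μ, Tendsto (fun n => empMean (fun i => V i ω) n j) atTop
      (𝓝 (meanVec μ (V 0) j)) := fun j =>
    ae_tendsto_average (f := fun x => x j) hindep hident (measurable_pi_apply j)
      ((hsq j).integrable one_le_two)
  filter_upwards [ae_all_iff.2 h] with ω hω
  exact tendsto_pi_nhds.2 hω

variable [DecidableEq ι]

lemma ae_tendsto_empCov (lam : ℝ) :
    ∀ᵐ ω ∂μ, Tendsto (fun n => empCov lam (fun i => V i ω) n) atTop
      (𝓝 (ridgeCov μ lam (V 0))) := by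
  have h : ∀ a : ι × ι, ∀ᵐ ω ∂μ, Tendsto
      (fun n : ℕ => (n : ℝ)⁻¹ * ∑ i : Fin n, V i ω a.1 * V i ω a.2) atTop
      (𝓝 (∫ ω, V 0 ω a.1 * V 0 ω a.2 ∂μ)) := fun a =>
    ae_tendsto_average (f := fun x => x a.1 * x a.2) hindep hident
      ((measurable_pi_apply _).mul (measurable_pi_apply _)) ((hsq a.1).integrable_mul (hsq a.2))
  filter_upwards [ae_all_iff.2 h, ae_tendsto_empMean hindep hident hsq] with ω hω hm
  refine tendsto_pi_nhds.2 fun a => tendsto_pi_nhds.2 fun b => ?_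
  have ha := tendsto_pi_nhds.1 hm a
  have hb := tendsto_pi_nhds.1 hm b
  have hcov : ridgeCov μ lam (V 0) a b = ∫ ω, V 0 ω a * V 0 ω b ∂μ -
      meanVec μ (V 0) a * meanVec μ (V 0) b + lam * (1 : Matrix ι ι ℝ) a b := by
    simp only [ridgeCov, Matrix.add_apply, Matrix.of_apply, Matrix.smul_apply, smul_eq_mul,
      covariance_eq_sub (hsq a) (hsq b), meanVec, Pi.mul_apply]
  rw [hcov]
  -- The centered second moment is the mean of products minus the product of means, an identity that
  -- needs `n ≠ 0`.
  refine (((hω (a, b)).sub (ha.mul hb)).add_const _).congr' ?_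
  filter_upwards [eventually_gt_atTop 0] with n hn
  have hn0 : (n : ℝ) ≠ 0 := by positivity
  simp only [empCov, Matrix.add_apply, Matrix.smul_apply, smul_eq_mul, Matrix.mul_apply,
    Matrix.transpose_apply, centered, Matrix.of_apply]
  have hS : ∀ c, ∑ i : Fin n, V i ω c = n * empMean (fun i => V i ω) n c := fun c => by
    rw [empMean, mul_inv_cancel_left₀ hn0]
  have e : ∑ i : Fin n, (V i ω a - empMean (fun i => V i ω) n a) *
      (V i ω b - empMean (fun i => V i ω) n b) = ∑ i : Fin n, V i ω a * V i ω b -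
      n * (empMean (fun i => V i ω) n a * empMean (fun i => V i ω) n b) := by
    simp only [sub_mul, mul_sub, Finset.sum_sub_distrib, ← Finset.mul_sum, ← Finset.sum_mul, hS,
      Finset.sum_const, Finset.card_univ, Fintype.card_fin, nsmul_eq_mul]
    ring
  rw [e, mul_sub, inv_mul_cancel_left₀ hn0]

omit hsq [DecidableEq ι]

/-- The functions `φ n ω` change with the sample, so the strong law does not apply to them directly.
It is applied instead to the indicator of a compact `K ⊆ F` of mass above `c`, on which `P`
eventually holds at all points. The deterministic margin `c' > c` later absorbs the rounding of the
rank. -/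
lemma ae_eventually_lt_card_of_isClosed (hmeas : Measurable (V 0))
    {φ : ℕ → Ω → (ι → ℝ) → ℝ} {P : ℝ → Prop} {F : Set (ι → ℝ)} (hF : IsClosed F)
    (hφ : ∀ᵐ ω ∂μ, ∀ K ⊆ F, IsCompact K → ∀ᶠ n in atTop, ∀ x ∈ K, P (φ n ω x))
    {c : ℝ} (hc : 0 ≤ c) (hcF : c < μ.real {ω | V 0 ω ∈ F}) [DecidablePred P] :
    ∃ c' > c, ∀ᵐ ω ∂μ, ∀ᶠ n : ℕ in atTop,
      c' * n < (Finset.univ.filter fun i : Fin n => P (φ n ω (V i ω))).card := by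
  classical
  have hFm : ENNReal.ofReal c < (μ.map (V 0)) F := by
    rw [Measure.map_apply hmeas hF.measurableSet]
    exact (ENNReal.ofReal_lt_iff_lt_toReal hc (measure_ne_top _ _)).2 hcF
  -- Inner regularity of the law of `V 0` by compact sets.
  obtain ⟨K, hKF, hK, hcK⟩ := hF.measurableSet.exists_lt_isCompact hFm
  rw [Measure.map_apply hmeas hK.measurableSet] at hcK
  have hcK' : c < μ.real (V 0 ⁻¹' K) :=
    (ENNReal.ofReal_lt_iff_lt_toReal hc (measure_ne_top _ _)).1 hcK
  obtain ⟨c', hcc', hc'⟩ := exists_between hcK'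
  refine ⟨c', hcc', ?_⟩
  have hint : Integrable (fun ω => K.indicator (fun _ => (1 : ℝ)) (V 0 ω)) μ :=
    (integrable_const (1 : ℝ)).indicator (hmeas hK.measurableSet)
  have hI : ∫ ω, K.indicator (fun _ => (1 : ℝ)) (V 0 ω) ∂μ = μ.real (V 0 ⁻¹' K) :=
    integral_indicator_one (hmeas hK.measurableSet)
  filter_upwards [hφ, ae_tendsto_average hindep hident
    (measurable_const.indicator hK.measurableSet) hint] with ω h1 h2
  rw [hI] at h2
  filter_upwards [h1 K hKF hK, h2.eventually_const_lt hc', eventually_gt_atTop 0] with n h3 h4 hn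
  have hn0 : (0 : ℝ) < n := by positivity
  have h5 : ∑ i : Fin n, K.indicator (fun _ => (1 : ℝ)) (V i ω) =
      (Finset.univ.filter fun i : Fin n => V i ω ∈ K).card := by
    simp [Set.indicator_apply]
  rw [h5, ← div_eq_inv_mul, lt_div_iff₀ hn0] at h4
  refine h4.trans_le ?_
  exact_mod_cast Finset.card_le_card
    (Finset.monotone_filter_right _ fun i _ hi => h3 _ hi)

variable [DecidableEq ι]

include hsq

lemma ae_tendsto_qEmp (hmeas : Measurable (V 0)) {α lam : ℝ} (hα0 : 0 < α) (hα1 : α < 1)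
    (hlam : 0 ≤ lam) (hM : (ridgeCov μ lam (V 0)).PosDef)
    (hq : ContinuousAt (quantile μ fun ω =>
      score (meanVec μ (V 0)) (ridgeCov μ lam (V 0))⁻¹ (V 0 ω)) (1 - α)) :
    ∀ᵐ ω ∂μ, Tendsto (fun n => qEmp lam α (fun i => V i ω) n) atTop
      (𝓝 (qLim μ lam α (V 0))) := by
  set m₀ := meanVec μ (V 0)
  set N₀ := (ridgeCov μ lam (V 0))⁻¹
  have hξ : Measurable fun ω => score m₀ N₀ (V 0 ω) :=
    (continuous_score_right m₀ N₀).measurable.comp hmeas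
  have hqL : qLim μ lam α (V 0) = quantile μ (fun ω => score m₀ N₀ (V 0 ω)) (1 - α) := rfl
  set q := qLim μ lam α (V 0)
  have hcov := ae_tendsto_empCov hindep hident hsq lam
  have hmean := ae_tendsto_empMean hindep hident hsq
  have hpd : ∀ᵐ ω ∂μ, ∀ᶠ n in atTop, (empCov lam (fun i => V i ω) n).PosDef := by
    filter_upwards [hcov] with ω hω
    exact eventually_posDef hω hM fun n => posSemidef_empCov hlam _ n
  have hφ : ∀ {F : Set (ι → ℝ)} {U : Set ℝ}, IsOpen U → (∀ x ∈ F, score m₀ N₀ x ∈ U) →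
      ∀ᵐ ω ∂μ, ∀ K ⊆ F, IsCompact K → ∀ᶠ n in atTop, ∀ x ∈ K,
        score (empMean (fun i => V i ω) n) (empCov lam (fun i => V i ω) n)⁻¹ x ∈ U := by
    intro F U hU hFU
    filter_upwards [hcov, hmean] with ω h1 h2 K hKF hK
    exact eventually_score_of_isCompact h2 (tendsto_matrix_inv h1 hM) hK hU
      fun x hx => hFU x (hKF hx)
  have hrank := tendsto_rank_div hα1
  have hup : ∀ r : ℝ, q < r → ∀ᵐ ω ∂μ, ∀ᶠ n in atTop, qEmp lam α (fun i => V i ω) n ≤ r := by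
    intro r hr
    -- The gap between `s` and `r` turns a closed condition on the limit score into an open one on
    -- the estimated score.
    obtain ⟨s, hqs, hsr⟩ := exists_between hr
    have htail := tail_lt_of_quantile_lt hξ (show 1 - α < 1 by linarith) hq (hqL ▸ hqs)
    have hF : IsClosed {x | score m₀ N₀ x ≤ s} :=
      isClosed_le (continuous_score_right m₀ N₀) continuous_const
    have hpF : 1 - α < μ.real {ω | V 0 ω ∈ {x | score m₀ N₀ x ≤ s}} := by
      have hcompl : {ω | V 0 ω ∈ {x | score m₀ N₀ x ≤ s}} =
          {ω | s < score m₀ N₀ (V 0 ω)}ᶜ := by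
        ext ω; simp
      rw [hcompl, probReal_compl_eq_one_sub (measurableSet_lt measurable_const hξ)]
      linarith
    obtain ⟨c, hc, hcount⟩ := ae_eventually_lt_card_of_isClosed hindep hident hmeas
      (P := fun y => y < r) hF (hφ isOpen_Iio fun x hx => lt_of_le_of_lt hx hsr)
      (by linarith) hpF
    filter_upwards [hcount, hpd] with ω h1 h2
    filter_upwards [h1, h2, eventually_rank_le hα0 hα1, hrank.eventually_lt_const hc,
      eventually_gt_atTop 0] with n h3 h4 h5 h6 hn
    rw [qEmp_le_iff hn hα1 h5 h4]
    have hn0 : (0 : ℝ) < n := by positivity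
    rw [div_lt_iff₀ hn0] at h6
    refine le_trans (by exact_mod_cast (h6.trans h3).le) (Finset.card_le_card
      (Finset.monotone_filter_right _ fun i _ hi => le_of_lt hi))
  have hlow : ∀ r : ℝ, r < q → ∀ᵐ ω ∂μ, ∀ᶠ n in atTop, r < qEmp lam α (fun i => V i ω) n := by
    intro r hr
    obtain ⟨s, hrs, hsq'⟩ := exists_between hr
    have htail := lt_tail_of_lt_quantile (show 0 < 1 - α by linarith) (hqL ▸ hsq')
    have hF : IsClosed {x | s ≤ score m₀ N₀ x} :=
      isClosed_le continuous_const (continuous_score_right m₀ N₀)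
    have hpF : α < μ.real {ω | V 0 ω ∈ {x | s ≤ score m₀ N₀ x}} := by
      refine lt_of_lt_of_le (by linarith) (measureReal_mono (fun ω hω => ?_)
        (h₂ := measure_ne_top _ _) : μ.real {ω | s < score m₀ N₀ (V 0 ω)} ≤ _)
      exact le_of_lt (show s < score m₀ N₀ (V 0 ω) from hω)
    obtain ⟨c, hc, hcount⟩ := ae_eventually_lt_card_of_isClosed hindep hident hmeas
      (P := fun y => r < y) hF (hφ isOpen_Ioi fun x hx => lt_of_lt_of_le hrs hx)
      hα0.le hpF
    filter_upwards [hcount, hpd] with ω h1 h2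
    filter_upwards [h1, h2, eventually_rank_le hα0 hα1,
      hrank.eventually_const_lt (show 1 - c < 1 - α by linarith),
      eventually_gt_atTop 0] with n h3 h4 h5 h6 hn
    rw [← not_le, qEmp_le_iff hn hα1 h5 h4, not_le]
    have hn0 : (0 : ℝ) < n := by positivity
    rw [lt_div_iff₀ hn0] at h6
    -- More than `c * n` scores exceed `r`, with `c > α`, so fewer than `(1 - c) * n` are at most
    -- `r`, which is below the required rank.
    have hsum := Finset.card_filter_add_card_filter_not (s := (Finset.univ : Finset (Fin n)))
      (fun i : Fin n => score (empMean (fun i => V i ω) n) (empCov lam (fun i => V i ω) n)⁻¹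
        (V i ω) ≤ r)
    simp only [not_le, Finset.card_univ, Fintype.card_fin] at hsum
    have hsum' : ((Finset.univ.filter fun i : Fin n => score (empMean (fun i => V i ω) n)
        (empCov lam (fun i => V i ω) n)⁻¹ (V i ω) ≤ r).card : ℝ) +
        (Finset.univ.filter fun i : Fin n => r < score (empMean (fun i => V i ω) n)
        (empCov lam (fun i => V i ω) n)⁻¹ (V i ω)).card = n := by exact_mod_cast hsum
    have : ((Finset.univ.filter fun i : Fin n => score (empMean (fun i => V i ω) n)
        (empCov lam (fun i => V i ω) n)⁻¹ (V i ω) ≤ r).card : ℝ) <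
        (⌈(1 - α) * ((n : ℝ) + 1)⌉₊ : ℝ) := by linarith
    exact_mod_cast this
  -- Restricting to rational thresholds leaves countably many null sets.
  have hup' : ∀ᵐ ω ∂μ, ∀ r : ℚ, q < r → ∀ᶠ n in atTop, qEmp lam α (fun i => V i ω) n ≤ r :=
    ae_all_iff.2 fun r => by
      by_cases h : q < r
      · filter_upwards [hup r h] with ω hω _ using hω
      · exact Eventually.of_forall fun ω h' => absurd h' h
  have hlow' : ∀ᵐ ω ∂μ, ∀ r : ℚ, r < q → ∀ᶠ n in atTop, r < qEmp lam α (fun i => V i ω) n :=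
    ae_all_iff.2 fun r => by
      by_cases h : r < q
      · filter_upwards [hlow r h] with ω hω _ using hω
      · exact Eventually.of_forall fun ω h' => absurd h' h
  filter_upwards [hup', hlow'] with ω h1 h2
  refine tendsto_order.2 ⟨fun a ha => ?_, fun a ha => ?_⟩
  · obtain ⟨r, har, hrq⟩ := exists_rat_btwn ha
    exact (h2 r hrq).mono fun n hn => har.trans hn
  · obtain ⟨r, hqr, hra⟩ := exists_rat_btwn ha
    exact (h1 r hqr).mono fun n hn => hn.trans_lt hra

end AlmostSure

/-! ### Replacing the new observation by an independent copy -/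

section Transfer

variable {Ω : Type*} [MeasurableSpace Ω] {μ : Measure Ω} [IsProbabilityMeasure μ]
  {E : Type*} [MeasurableSpace E] {V : ℕ → Ω → E}

/-- The first `n` observations are independent of `V n`, which has the law of `V 0`, so their joint
law is a product. A functional of the first `n + 1` coordinates sees nothing else. -/
lemma integral_eq_integral_update (hmeas : ∀ i, Measurable (V i)) (hindep : iIndepFun V μ)
    (hident : ∀ i, IdentDistrib (V i) (V 0) μ μ) {n : ℕ} {T : (ℕ → E) → ℝ} (hT : Measurable T)
    (hcongr : ∀ v w : ℕ → E, (∀ i ≤ n, v i = w i) → T v = T w) :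
    ∫ ω, T (fun i => V i ω) ∂μ =
      ∫ p, T (Function.update (fun i => V i p.1) n p.2) ∂(μ.prod (μ.map (V 0))) := by
  have : Nonempty E := (nonempty_of_isProbabilityMeasure μ).map (V 0)
  let e : E := Classical.arbitrary E
  -- Padding with a constant gives a sequence that is a function of the first `n` observations
  -- alone, hence independent of `V n`.
  let φ : (↥(Finset.range n) → E) → ℕ → E :=
    fun y i => if h : i ∈ Finset.range n then y ⟨i, h⟩ else e
  have hφ : Measurable φ := by
    refine measurable_pi_lambda _ fun i => ?_
    by_cases h : i ∈ Finset.range n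
    · simp only [φ, dif_pos h]
      exact measurable_pi_apply _
    · simp only [φ, dif_neg h]
      exact measurable_const
  let W : Ω → ℕ → E := fun ω => φ fun i => V i ω
  have hW : Measurable W := hφ.comp (measurable_pi_lambda _ fun i => hmeas i)
  have hWV : ∀ ω, ∀ i < n, W ω i = V i ω := fun ω i hi => by simp [W, φ, hi]
  have hWi : IndepFun W (V n) μ := by
    have h := hindep.indepFun_finset (Finset.range n) {n} (by simp) hmeas
    exact h.comp hφ (measurable_pi_apply (⟨n, by simp⟩ : ({n} : Finset ℕ)))
  have : IsProbabilityMeasure (μ.map (V 0)) :=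
    Measure.isProbabilityMeasure_map (hmeas 0).aemeasurable
  have hlaw : μ.map (fun ω => (W ω, V n ω)) =
      (μ.prod (μ.map (V 0))).map (Prod.map W id) := by
    rw [(indepFun_iff_map_prod_eq_prod_map_map hW.aemeasurable (hmeas n).aemeasurable).1 hWi,
      (hident n).map_eq, ← Measure.map_prod_map _ _ hW measurable_id, Measure.map_id]
  have hg : Measurable fun p : (ℕ → E) × E => T (Function.update p.1 n p.2) :=
    hT.comp measurable_update'
  calc ∫ ω, T (fun i => V i ω) ∂μ
      = ∫ ω, T (Function.update (W ω) n (V n ω)) ∂μ := by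
        refine integral_congr_ae (Eventually.of_forall fun ω => hcongr _ _ fun i hi => ?_)
        rcases hi.lt_or_eq with h | rfl
        · rw [Function.update_of_ne h.ne, hWV ω i h]
        · simp
    _ = ∫ p, T (Function.update p.1 n p.2) ∂(μ.map fun ω => (W ω, V n ω)) :=
        (integral_map (hW.prodMk (hmeas n)).aemeasurable hg.aestronglyMeasurable).symm
    _ = ∫ p, T (Function.update (W p.1) n p.2) ∂(μ.prod (μ.map (V 0))) := by
        rw [hlaw, integral_map (hW.prodMap measurable_id).aemeasurable hg.aestronglyMeasurable]
        rfl
    _ = _ := by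
        refine integral_congr_ae (Eventually.of_forall fun p => hcongr _ _ fun i hi => ?_)
        rcases hi.lt_or_eq with h | rfl
        · rw [Function.update_of_ne h.ne, Function.update_of_ne h.ne, hWV _ i h]
        · simp

/-- Dominated convergence on the product of `μ` with the law of `V 0`. The set `S` of full measure
allows exceptional values of the new observation. -/
lemma tendsto_integral_of_ae_tendsto_update (hmeas : ∀ i, Measurable (V i))
    (hindep : iIndepFun V μ) (hident : ∀ i, IdentDistrib (V i) (V 0) μ μ)
    {T : ℕ → (ℕ → E) → ℝ} (hT : ∀ n, Measurable (T n))
    (hcongr : ∀ n, ∀ v w : ℕ → E, (∀ i ≤ n, v i = w i) → T n v = T n w)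
    {C : ℝ} (hC : ∀ n v, |T n v| ≤ C) {G : E → ℝ} (hG : Measurable G)
    {S : Set E} (hS : ∀ᵐ ω ∂μ, V 0 ω ∈ S) (hSm : MeasurableSet S)
    (hlim : ∀ᵐ ω ∂μ, ∀ x ∈ S,
      Tendsto (fun n => T n (Function.update (fun i => V i ω) n x)) atTop (𝓝 (G x))) :
    Tendsto (fun n => ∫ ω, T n (fun i => V i ω) ∂μ) atTop (𝓝 (∫ ω, G (V 0 ω) ∂μ)) := by
  have : IsProbabilityMeasure (μ.map (V 0)) :=
    Measure.isProbabilityMeasure_map (hmeas 0).aemeasurable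
  have hGint : ∫ ω, G (V 0 ω) ∂μ = ∫ p, G p.2 ∂(μ.prod (μ.map (V 0))) := by
    rw [integral_fun_snd (fun x => G x), integral_map (hmeas 0).aemeasurable
      hG.aestronglyMeasurable]
    simp
  rw [hGint]
  simp_rw [fun n => integral_eq_integral_update hmeas hindep hident (hT n) (hcongr n)]
  refine tendsto_integral_of_dominated_convergence (fun _ => C) (fun n => ?_) (integrable_const C)
    (fun n => Eventually.of_forall fun p => hC n _) ?_
  · refine ((hT n).comp (measurable_update'.comp (Measurable.prodMk
      (measurable_pi_lambda _ fun i => (hmeas i).comp measurable_fst)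
      measurable_snd))).aestronglyMeasurable
  · have h1 := Measure.quasiMeasurePreserving_fst (μ := μ) (ν := μ.map (V 0)) |>.ae hlim
    have h2 := Measure.quasiMeasurePreserving_snd (μ := μ) (ν := μ.map (V 0)) |>.ae
      ((ae_map_iff (hmeas 0).aemeasurable hSm).2 hS)
    filter_upwards [h1, h2] with p hp1 hp2
    exact hp1 p.2 hp2

lemma tendstoInDistribution_of_ae_tendsto_update (hmeas : ∀ i, Measurable (V i))
    (hindep : iIndepFun V μ) (hident : ∀ i, IdentDistrib (V i) (V 0) μ μ)
    {F : Type*} [TopologicalSpace F] [MeasurableSpace F] [BorelSpace F]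
    {T : ℕ → (ℕ → E) → F} (hT : ∀ n, Measurable (T n))
    (hcongr : ∀ n, ∀ v w : ℕ → E, (∀ i ≤ n, v i = w i) → T n v = T n w)
    {G : E → F} (hG : Measurable G)
    (hlim : ∀ᵐ ω ∂μ, ∀ x,
      Tendsto (fun n => T n (Function.update (fun i => V i ω) n x)) atTop (𝓝 (G x))) :
    TendstoInDistribution (fun n ω => T n (fun i => V i ω)) atTop (fun ω => G (V 0 ω))
      (fun _ => μ) μ := by
  have hV : Measurable fun ω i => V i ω := measurable_pi_lambda _ hmeas
  refine ⟨fun n => ((hT n).comp hV).aemeasurable, (hG.comp (hmeas 0)).aemeasurable, ?_⟩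
  refine ProbabilityMeasure.tendsto_iff_forall_integral_tendsto.2 fun f => ?_
  have h := tendsto_integral_of_ae_tendsto_update hmeas hindep hident
    (T := fun n v => f (T n v)) (fun n => f.continuous.measurable.comp (hT n))
    (fun n v w hvw => by rw [hcongr n v w hvw]) (C := ‖f‖) (fun n v => f.norm_coe_le_norm _)
    (G := fun x => f (G x)) (f.continuous.measurable.comp hG) (S := Set.univ)
    (Eventually.of_forall fun _ => trivial) MeasurableSet.univ
    (by filter_upwards [hlim] with ω hω x _ using (f.continuous.tendsto _).comp (hω x))
  convert h using 2 with n
  · exact integral_map ((hT n).comp hV).aemeasurable f.continuous.measurable.aestronglyMeasurable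
  · exact integral_map (hG.comp (hmeas 0)).aemeasurable f.continuous.measurable.aestronglyMeasurable

/-- Indicators are not continuous, so convergence is asked as eventual agreement, off an exceptional
null set for the new observation. -/
lemma tendsto_measureReal_of_ae_eventually_update (hmeas : ∀ i, Measurable (V i))
    (hindep : iIndepFun V μ) (hident : ∀ i, IdentDistrib (V i) (V 0) μ μ)
    {A : ℕ → Set (ℕ → E)} (hA : ∀ n, MeasurableSet (A n))
    (hcongr : ∀ n, ∀ v w : ℕ → E, (∀ i ≤ n, v i = w i) → (v ∈ A n ↔ w ∈ A n))
    {B : Set E} (hB : MeasurableSet B)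
    {S : Set E} (hS : ∀ᵐ ω ∂μ, V 0 ω ∈ S) (hSm : MeasurableSet S)
    (hlim : ∀ᵐ ω ∂μ, ∀ x ∈ S,
      ∀ᶠ n in atTop, (Function.update (fun i => V i ω) n x ∈ A n ↔ x ∈ B)) :
    Tendsto (fun n => μ.real {ω | (fun i => V i ω) ∈ A n}) atTop
      (𝓝 (μ.real {ω | V 0 ω ∈ B})) := by
  classical
  have hV : Measurable fun ω i => V i ω := measurable_pi_lambda _ hmeas
  have h := tendsto_integral_of_ae_tendsto_update hmeas hindep hident
    (T := fun n => (A n).indicator fun _ => (1 : ℝ)) (G := B.indicator fun _ => (1 : ℝ)) (C := 1)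
    (fun n => measurable_const.indicator (hA n))
    (fun n v w hvw => by simp only [Set.indicator_apply, hcongr n v w hvw])
    (fun n v => by
      simp only [Set.indicator_apply]
      split_ifs <;> simp)
    (measurable_const.indicator hB) hS hSm (by
      filter_upwards [hlim] with ω hω x hx
      refine tendsto_const_nhds.congr' ?_
      filter_upwards [hω x hx] with n hn
      simp only [Set.indicator_apply, hn])
  have e1 : ∀ n, ∫ ω, (A n).indicator (fun _ => (1 : ℝ)) (fun i => V i ω) ∂μ =
      μ.real {ω | (fun i => V i ω) ∈ A n} := fun n => integral_indicator_one (hV (hA n))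
  have e2 : ∫ ω, B.indicator (fun _ => (1 : ℝ)) (V 0 ω) ∂μ = μ.real {ω | V 0 ω ∈ B} :=
    integral_indicator_one (hmeas 0 hB)
  rw [← e2]
  exact h.congr e1

end Transfer

/-! ### Limits with a fixed new observation -/

section FixedObservation

lemma update_eq_of_lt {E : Type*} (v : ℕ → E) (n : ℕ) (x : E) :
    ∀ i < n, Function.update v n x i = v i :=
  fun _ hi => Function.update_of_ne hi.ne _ _

variable {k l : ℕ} {v : ℕ → (Fin k ⊕ Fin l) → ℝ} {m : Fin k ⊕ Fin l → ℝ}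
  {M : Matrix (Fin k ⊕ Fin l) (Fin k ⊕ Fin l) ℝ} {lam α q : ℝ}

/-- The quadratic form `(x₁ - m₁)ᵀ (M¹¹)⁻¹ (x₁ - m₁)` in the first block `x₁` of `x`. -/
def blockQuad (m : Fin k ⊕ Fin l → ℝ) (M : Matrix (Fin k ⊕ Fin l) (Fin k ⊕ Fin l) ℝ)
    (x : Fin k ⊕ Fin l → ℝ) : ℝ :=
  (fun j => x (Sum.inl j) - m (Sum.inl j)) ⬝ᵥ
    (M.toBlocks₁₁⁻¹ *ᵥ fun j => x (Sum.inl j) - m (Sum.inl j))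

lemma measurable_blockQuad (m : Fin k ⊕ Fin l → ℝ)
    (M : Matrix (Fin k ⊕ Fin l) (Fin k ⊕ Fin l) ℝ) : Measurable (blockQuad m M) := by
  have h : ∀ j, Measurable fun x : Fin k ⊕ Fin l → ℝ => x (Sum.inl j) - m (Sum.inl j) :=
    fun j => (measurable_pi_apply _).sub_const _
  exact measurable_dotProduct h (measurable_mulVec (fun _ _ => measurable_const) h)

/-- The affine map `x ↦ M²¹ (M¹¹)⁻¹ (x₁ - m₁) + m₂`, with `x₁` the first block of `x`. -/
def blockCenter (m : Fin k ⊕ Fin l → ℝ) (M : Matrix (Fin k ⊕ Fin l) (Fin k ⊕ Fin l) ℝ)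
    (x : Fin k ⊕ Fin l → ℝ) : Fin l → ℝ :=
  (M.toBlocks₂₁ * M.toBlocks₁₁⁻¹) *ᵥ (fun j => x (Sum.inl j) - m (Sum.inl j)) +
    fun j => m (Sum.inr j)

lemma measurable_blockCenter (m : Fin k ⊕ Fin l → ℝ)
    (M : Matrix (Fin k ⊕ Fin l) (Fin k ⊕ Fin l) ℝ) : Measurable (blockCenter m M) := by
  have h : ∀ j, Measurable fun x : Fin k ⊕ Fin l → ℝ => x (Sum.inl j) - m (Sum.inl j) :=
    fun j => (measurable_pi_apply _).sub_const _
  exact measurable_pi_lambda _ fun i =>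
    (measurable_mulVec (A := fun _ => M.toBlocks₂₁ * M.toBlocks₁₁⁻¹)
      (fun _ _ => measurable_const) h i).add measurable_const

lemma continuous_toBlocks₁₁ : Continuous fun M : Matrix (Fin k ⊕ Fin l) (Fin k ⊕ Fin l) ℝ =>
    M.toBlocks₁₁ :=
  continuous_id.matrix_submatrix Sum.inl Sum.inl

lemma continuous_toBlocks₁₂ : Continuous fun M : Matrix (Fin k ⊕ Fin l) (Fin k ⊕ Fin l) ℝ =>
    M.toBlocks₁₂ :=
  continuous_id.matrix_submatrix Sum.inl Sum.inr

lemma continuous_toBlocks₂₁ : Continuous fun M : Matrix (Fin k ⊕ Fin l) (Fin k ⊕ Fin l) ℝ =>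
    M.toBlocks₂₁ :=
  continuous_id.matrix_submatrix Sum.inr Sum.inl

lemma continuous_toBlocks₂₂ : Continuous fun M : Matrix (Fin k ⊕ Fin l) (Fin k ⊕ Fin l) ℝ =>
    M.toBlocks₂₂ :=
  continuous_id.matrix_submatrix Sum.inr Sum.inr

lemma tendsto_toBlocks₁₁_inv {A : ℕ → Matrix (Fin k ⊕ Fin l) (Fin k ⊕ Fin l) ℝ}
    (h : Tendsto A atTop (𝓝 M)) (hM : M.PosDef) :
    Tendsto (fun n => (A n).toBlocks₁₁⁻¹) atTop (𝓝 M.toBlocks₁₁⁻¹) :=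
  tendsto_matrix_inv ((continuous_toBlocks₁₁.tendsto M).comp h) (posDef_toBlocks₁₁ hM)

lemma tendsto_toBlocks₂₁_mul_inv {A : ℕ → Matrix (Fin k ⊕ Fin l) (Fin k ⊕ Fin l) ℝ}
    (h : Tendsto A atTop (𝓝 M)) (hM : M.PosDef) :
    Tendsto (fun n => (A n).toBlocks₂₁ * (A n).toBlocks₁₁⁻¹) atTop
      (𝓝 (M.toBlocks₂₁ * M.toBlocks₁₁⁻¹)) := by
  have hmul : Continuous fun p : Matrix (Fin l) (Fin k) ℝ × Matrix (Fin k) (Fin k) ℝ =>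
      p.1 * p.2 := continuous_fst.matrix_mul continuous_snd
  have h21 : Tendsto (fun n => (A n).toBlocks₂₁) atTop (𝓝 M.toBlocks₂₁) :=
    (continuous_toBlocks₂₁.tendsto M).comp h
  exact (hmul.tendsto (M.toBlocks₂₁, M.toBlocks₁₁⁻¹)).comp
    (h21.prodMk_nhds (tendsto_toBlocks₁₁_inv h hM))

lemma tendsto_schur {A : ℕ → Matrix (Fin k ⊕ Fin l) (Fin k ⊕ Fin l) ℝ}
    (h : Tendsto A atTop (𝓝 M)) (hM : M.PosDef) :
    Tendsto (fun n => schur (A n)) atTop (𝓝 (schur M)) := by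
  have hmul : Continuous fun p : Matrix (Fin l) (Fin k) ℝ × Matrix (Fin k) (Fin l) ℝ =>
      p.1 * p.2 := continuous_fst.matrix_mul continuous_snd
  have h12 : Tendsto (fun n => (A n).toBlocks₁₂) atTop (𝓝 M.toBlocks₁₂) :=
    (continuous_toBlocks₁₂.tendsto M).comp h
  have h22 : Tendsto (fun n => (A n).toBlocks₂₂) atTop (𝓝 M.toBlocks₂₂) :=
    (continuous_toBlocks₂₂.tendsto M).comp h
  have h3 := (hmul.tendsto (M.toBlocks₂₁ * M.toBlocks₁₁⁻¹, M.toBlocks₁₂)).comp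
    ((tendsto_toBlocks₂₁_mul_inv h hM).prodMk_nhds h12)
  exact h22.sub h3

lemma tendsto_newX_update (hmean : Tendsto (fun n => empMean v n) atTop (𝓝 m))
    (x : Fin k ⊕ Fin l → ℝ) :
    Tendsto (fun n => newX (Function.update v n x) n) atTop
      (𝓝 fun j => x (Sum.inl j) - m (Sum.inl j)) := by
  refine tendsto_pi_nhds.2 fun j => ?_
  simp only [newX, Function.update_self, fun n => empMean_congr (update_eq_of_lt v n x)]
  exact (tendsto_pi_nhds.1 hmean _).const_sub _

lemma tendsto_center_update (hmean : Tendsto (fun n => empMean v n) atTop (𝓝 m))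
    (hcov : Tendsto (fun n => empCov lam v n) atTop (𝓝 M)) (hM : M.PosDef)
    (x : Fin k ⊕ Fin l → ℝ) :
    Tendsto (fun n => center lam (Function.update v n x) n) atTop
      (𝓝 (blockCenter m M x)) := by
  have hmul : Continuous fun p : Matrix (Fin l) (Fin k) ℝ × (Fin k → ℝ) => p.1 *ᵥ p.2 :=
    continuous_fst.matrix_mulVec continuous_snd
  simp only [center, fun n => empMean_congr (update_eq_of_lt v n x),
    fun n => empCov_congr (update_eq_of_lt v n x) lam]
  have h1 := (hmul.tendsto (M.toBlocks₂₁ * M.toBlocks₁₁⁻¹, _)).comp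
    ((tendsto_toBlocks₂₁_mul_inv hcov hM).prodMk_nhds (tendsto_newX_update hmean x))
  have h2 : Tendsto (fun n => fun j => empMean v n (Sum.inr j)) atTop
      (𝓝 fun j => m (Sum.inr j)) :=
    tendsto_pi_nhds.2 fun j => tendsto_pi_nhds.1 hmean _
  exact h1.add h2

lemma tendsto_rho_update (hmean : Tendsto (fun n => empMean v n) atTop (𝓝 m))
    (hcov : Tendsto (fun n => empCov lam v n) atTop (𝓝 M)) (hM : M.PosDef)
    (hq : Tendsto (fun n => qEmp lam α v n) atTop (𝓝 q)) (x : Fin k ⊕ Fin l → ℝ) :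
    Tendsto (fun n => rho lam α (Function.update v n x) n) atTop
      (𝓝 (q - blockQuad m M x)) := by
  have hquad : Continuous fun p : Matrix (Fin k) (Fin k) ℝ × (Fin k → ℝ) =>
      p.2 ⬝ᵥ (p.1 *ᵥ p.2) :=
    continuous_snd.dotProduct (continuous_fst.matrix_mulVec continuous_snd)
  simp only [rho, fun n => qEmp_congr (update_eq_of_lt v n x) lam α,
    fun n => empCov_congr (update_eq_of_lt v n x) lam]
  -- As `qEmp` converges, the correction in the denominator vanishes and the two units cancel.
  have h1 : Tendsto (fun n : ℕ => (qEmp lam α v n + 1) / n) atTop (𝓝 0) :=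
    (hq.add_const 1).div_atTop tendsto_natCast_atTop_atTop
  have h2 := ((hq.add_const 1).div (h1.const_sub 1) (by norm_num)).sub_const 1
  simp only [sub_zero, div_one, add_sub_cancel_right] at h2
  exact h2.sub ((hquad.tendsto (M.toBlocks₁₁⁻¹, _)).comp
    ((tendsto_toBlocks₁₁_inv hcov hM).prodMk_nhds (tendsto_newX_update hmean x)))

lemma eventually_qEmp_lt (hq : Tendsto (fun n => qEmp lam α v n) atTop (𝓝 q)) :
    ∀ᶠ n : ℕ in atTop, qEmp lam α v n < (n : ℝ) - 1 := by
  filter_upwards [hq.eventually_lt_const (lt_add_one q),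
    tendsto_natCast_atTop_atTop.eventually_gt_atTop (q + 2)] with n h1 h2
  linarith

/-- Eventually the region is a true ellipsoid with positive definite matrix. Its volume depends
continuously on the radius even at zero, so no boundary case is excluded. -/
lemma tendsto_volume_region_update (hl : 1 ≤ l) (hlam : 0 ≤ lam)
    (hmean : Tendsto (fun n => empMean v n) atTop (𝓝 m))
    (hcov : Tendsto (fun n => empCov lam v n) atTop (𝓝 M)) (hM : M.PosDef)
    (hq : Tendsto (fun n => qEmp lam α v n) atTop (𝓝 q)) (x : Fin k ⊕ Fin l → ℝ) :
    Tendsto (fun n => volume (region lam α (Function.update v n x) n)) atTop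
      (𝓝 (ENNReal.ofReal (unitBallVol l * Real.sqrt (schur M).det *
        (max 0 (q - blockQuad m M x)) ^ ((l : ℝ) / 2)))) := by
  have hA : Tendsto (fun n => matA lam v n) atTop (𝓝 (schur M)) := tendsto_schur hcov hM
  have hdet : Tendsto (fun n => (matA lam v n).det) atTop (𝓝 (schur M).det) :=
    (continuous_id.matrix_det.tendsto _).comp hA
  have hρ := tendsto_rho_update hmean hcov hM hq x
  have hmax := ((tendsto_const_nhds (x := (0 : ℝ))).max hρ).rpow_const
    (p := (l : ℝ) / 2) (Or.inr (by positivity))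
  refine (ENNReal.tendsto_ofReal ((hdet.sqrt.const_mul (unitBallVol l)).mul hmax)).congr' ?_
  filter_upwards [eventually_qEmp_lt hq, eventually_posDef hA (posDef_schur hM)
    fun n => posSemidef_schur (posSemidef_empCov hlam v n)] with n h1 h2
  have hmatA : matA lam (Function.update v n x) n = matA lam v n := by
    rw [matA, matA, empCov_congr (update_eq_of_lt v n x)]
  have hqe : qEmp lam α (Function.update v n x) n = qEmp lam α v n :=
    qEmp_congr (update_eq_of_lt v n x) lam α
  rw [← volume_ellipsoid hl h2 (center lam (Function.update v n x) n)]
  simp only [region, hmatA, hqe, h1, true_imp_iff]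

/-- The limit squared radius is nonzero by `hx`, so the sign of the squared radius settles. -/
lemma eventually_region_update_eq_empty_iff (hlam : 0 ≤ lam)
    (hmean : Tendsto (fun n => empMean v n) atTop (𝓝 m))
    (hcov : Tendsto (fun n => empCov lam v n) atTop (𝓝 M)) (hM : M.PosDef)
    (hq : Tendsto (fun n => qEmp lam α v n) atTop (𝓝 q)) {x : Fin k ⊕ Fin l → ℝ}
    (hx : blockQuad m M x ≠ q) :
    ∀ᶠ n in atTop, (region lam α (Function.update v n x) n = ∅ ↔ q < blockQuad m M x) := by
  have hρ := tendsto_rho_update hmean hcov hM hq x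
  simp only [region_eq_empty_iff hlam, fun n => qEmp_congr (update_eq_of_lt v n x) lam α]
  rcases lt_or_gt_of_ne hx with h | h
  · filter_upwards [hρ.eventually_const_lt (sub_pos.2 h)] with n hn
    simp [not_lt.2 h.le, not_lt.2 hn.le]
  · filter_upwards [eventually_qEmp_lt hq, hρ.eventually_lt_const (sub_neg.2 h)] with n h1 h2
    simp [h, h1, h2]

end FixedObservation

end CCLE

end

/-! ### Asymptotics of the confidence ellipsoid -/

theorem proposition4p1 {Ω : Type*} [MeasurableSpace Ω] (μ : Measure Ω) [IsProbabilityMeasure μ]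
    (k l : ℕ) (hk : 1 ≤ k) (hl : 1 ≤ l)
    (V : ℕ → Ω → (Fin k ⊕ Fin l) → ℝ)
    (hmeas : ∀ i, Measurable (V i))
    (hindep : iIndepFun V μ)
    (hident : ∀ i, IdentDistrib (V i) (V 0) μ μ)
    (hsq : ∀ j, MemLp (fun ω => V 0 ω j) 2 μ)
    (α : ℝ) (hα0 : 0 < α) (hα1 : α < 1)
    (lam : ℝ)
    (hlam : 0 < lam ∨ (lam = 0 ∧ IsUnit (CCLE.ridgeCov μ 0 (V 0))))
    (hquant : ∃ U ∈ 𝓝 (1 - α),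
      ContinuousOn (CCLE.quantile μ (CCLE.normScore μ lam (V 0))) U) :
    (∀ᵐ ω ∂μ, Tendsto (fun n => CCLE.qEmp lam α (fun i => V i ω) n) atTop
      (𝓝 (CCLE.qLim μ lam α (V 0)))) ∧
    (∀ᵐ ω ∂μ, Tendsto (fun n => CCLE.matA lam (fun i => V i ω) n) atTop
      (𝓝 ((CCLE.extractL k l)ᵀ * (CCLE.ridgeCov μ lam (V 0))⁻¹ * CCLE.extractL k l)⁻¹)) ∧
    ((CCLE.extractL k l)ᵀ * (CCLE.ridgeCov μ lam (V 0))⁻¹ * CCLE.extractL k l)⁻¹ =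
      CCLE.schur (CCLE.ridgeCov μ lam (V 0)) ∧
    TendstoInDistribution (fun n ω => CCLE.rho lam α (fun i => V i ω) n) atTop
      (fun ω => CCLE.qLim μ lam α (V 0) - CCLE.quadX μ lam (V 0) ω) (fun _ => μ) μ ∧
    TendstoInDistribution (fun n ω => CCLE.center lam (fun i => V i ω) n) atTop
      (fun ω => CCLE.limCenter μ lam (V 0) ω) (fun _ => μ) μ ∧
    TendstoInDistribution
      (fun n ω => (volume (CCLE.region lam α (fun i => V i ω) n) : ℝ≥0∞)) atTop
      (fun ω => ENNReal.ofReal (CCLE.limVol μ lam α (V 0) ω)) (fun _ => μ) μ ∧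
    (μ {ω | CCLE.quadX μ lam (V 0) ω = CCLE.qLim μ lam α (V 0)} = 0 →
      Tendsto (fun n => μ.real {ω | CCLE.region lam α (fun i => V i ω) n = ∅}) atTop
        (𝓝 (μ.real {ω | CCLE.qLim μ lam α (V 0) < CCLE.quadX μ lam (V 0) ω}))) ∧
    μ.real {ω | CCLE.qLim μ lam α (V 0) < CCLE.quadX μ lam (V 0) ω} ≤ α := by

  have hlam0 : 0 ≤ lam := by
    rcases hlam with h | ⟨rfl, _⟩
    exacts [h.le, le_rfl]
  have hM := CCLE.posDef_ridgeCov hsq hlam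
  have hscore : CCLE.normScore μ lam (V 0) = fun ω => CCLE.score (CCLE.meanVec μ (V 0))
      (CCLE.ridgeCov μ lam (V 0))⁻¹ (V 0 ω) :=
    funext fun ω => CCLE.norm_sq_invSqrt_mulVec hM _
  have hqc : ContinuousAt (CCLE.quantile μ fun ω => CCLE.score (CCLE.meanVec μ (V 0))
      (CCLE.ridgeCov μ lam (V 0))⁻¹ (V 0 ω)) (1 - α) := by
    obtain ⟨U, hU, hUc⟩ := hquant
    rw [hscore] at hUc
    exact hUc.continuousAt hU
  have hq := CCLE.ae_tendsto_qEmp hindep hident hsq (hmeas 0) hα0 hα1 hlam0 hM hqc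
  have hcov := CCLE.ae_tendsto_empCov hindep hident hsq lam
  have hmean := CCLE.ae_tendsto_empMean hindep hident hsq
  have hL := CCLE.extractL_mul_inv_mul hM
  have hquad := CCLE.measurable_blockQuad (CCLE.meanVec μ (V 0)) (CCLE.ridgeCov μ lam (V 0))
  refine ⟨hq, ?_, hL, ?_, ?_, ?_, ?_, ?_⟩
  · filter_upwards [hcov] with ω hω
    rw [hL]
    exact CCLE.tendsto_schur hω hM
  -- By unfolding, `quadX` is `blockQuad` evaluated at `V 0 ω`; likewise `limCenter` is
  -- `blockCenter` below.
  · refine CCLE.tendstoInDistribution_of_ae_tendsto_update hmeas hindep hident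
      (CCLE.measurable_rho lam α) (fun n v w h => CCLE.rho_congr h lam α)
      (hquad.const_sub (CCLE.qLim μ lam α (V 0))) ?_
    filter_upwards [hcov, hmean, hq] with ω h1 h2 h3 x
    exact CCLE.tendsto_rho_update h2 h1 hM h3 x
  · refine CCLE.tendstoInDistribution_of_ae_tendsto_update hmeas hindep hident
      (CCLE.measurable_center lam) (fun n v w h => CCLE.center_congr h lam)
      (CCLE.measurable_blockCenter (CCLE.meanVec μ (V 0)) (CCLE.ridgeCov μ lam (V 0))) ?_
    filter_upwards [hcov, hmean] with ω h1 h2 x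
    exact CCLE.tendsto_center_update h2 h1 hM x
  · refine CCLE.tendstoInDistribution_of_ae_tendsto_update hmeas hindep hident
      (G := fun x => ENNReal.ofReal (CCLE.unitBallVol l *
        Real.sqrt (CCLE.schur (CCLE.ridgeCov μ lam (V 0))).det *
        (max 0 (CCLE.qLim μ lam α (V 0) -
          CCLE.blockQuad (CCLE.meanVec μ (V 0)) (CCLE.ridgeCov μ lam (V 0)) x)) ^ ((l : ℝ) / 2)))
      (CCLE.measurable_volume_region lam α)
      (fun n v w h => by rw [CCLE.region_congr h lam α]) ?_ ?_
    · exact (((measurable_const.max (hquad.const_sub _)).pow_const _).const_mul _).ennreal_ofReal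
    · filter_upwards [hcov, hmean, hq] with ω h1 h2 h3 x
      exact CCLE.tendsto_volume_region_update hl hlam0 h2 h1 hM h3 x
  · intro h0
    have hS : ∀ᵐ ω ∂μ, V 0 ω ∈ {x | CCLE.blockQuad (CCLE.meanVec μ (V 0))
        (CCLE.ridgeCov μ lam (V 0)) x ≠ CCLE.qLim μ lam α (V 0)} :=
      measure_eq_zero_iff_ae_notMem.1 h0
    have hSm : MeasurableSet {x | CCLE.blockQuad (CCLE.meanVec μ (V 0))
        (CCLE.ridgeCov μ lam (V 0)) x ≠ CCLE.qLim μ lam α (V 0)} :=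
      (hquad (measurableSet_singleton _)).compl
    have hB : MeasurableSet {x | CCLE.qLim μ lam α (V 0) <
        CCLE.blockQuad (CCLE.meanVec μ (V 0)) (CCLE.ridgeCov μ lam (V 0)) x} :=
      measurableSet_lt measurable_const hquad
    have hA : ∀ n, MeasurableSet {v : ℕ → (Fin k ⊕ Fin l) → ℝ | CCLE.region lam α v n = ∅} := by
      intro n
      simp only [CCLE.region_eq_empty_iff hlam0]
      exact (measurableSet_lt (CCLE.measurable_qEmp lam α n) measurable_const).inter
        (measurableSet_lt (CCLE.measurable_rho lam α n) measurable_const)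
    have hlim := CCLE.tendsto_measureReal_of_ae_eventually_update hmeas hindep hident hA
      (fun n v w h => by simp only [Set.mem_ofPred_eq, CCLE.region_congr h]) hB hS hSm (by
        filter_upwards [hcov, hmean, hq] with ω h1 h2 h3 x hx
        exact CCLE.eventually_region_update_eq_empty_iff hlam0 h2 h1 hM h3 hx)
    simp only [Set.mem_ofPred_eq] at hlim
    exact hlim
  -- The full score exceeds its own quantile with probability at most `α`, and it dominates the
  -- covariate form.
  · have htail := CCLE.tail_quantile_le (μ := μ) (u := 1 - α)
      (ξ := fun ω => CCLE.score (CCLE.meanVec μ (V 0)) (CCLE.ridgeCov μ lam (V 0))⁻¹ (V 0 ω))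
      ((CCLE.continuous_score_right _ _).measurable.comp (hmeas 0)) (by linarith)
    rw [sub_sub_cancel] at htail
    refine (measureReal_mono fun ω hω => ?_).trans htail
    exact lt_of_lt_of_le hω
      (CCLE.dotProduct_inv_toBlocks₁₁_le hM (V 0 ω - CCLE.meanVec μ (V 0)))
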